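/- Let $A$ be a finite alphabet. For a nonempty word $w\in A^+$ with positions $dom(w)=\{1,\dots,|w|\}$ and letters $w[1],\dots,w[|w|]$, consider the following logics. **The logic $TL[X_a,Y_a]$** has the formulas $$\varphi ::= a \mid \top \mid X_a\varphi \mid Y_a\varphi \mid SP\,\varphi \mid EP\,\varphi \mid \varphi\lor\varphi \mid \neg\varphi \mid \widetilde X_a\varphi \mid \widetilde Y_a\varphi \mid \bigcirc\varphi \mid \ominus\varphi \qquad (a\in A).$$ For $i\in dom(w)$, $w,i\models a$ iff $w[i]=a$; $\top$, $\lor$, $\neg$ are as usual; $w,i\models X_a\varphi$ iff there is $j>i$ with $w[j]=a$, $w[k]\ne a$ for all $i<k<j$, and $w,j\models\varphi$; $w,i\models Y_a\varphi$ iff there is $j<i$ with $w[j]=a$, $w[k]\neq a$ for all $j<k<i$, and $w,j\models\varphi$; $w,i\models\widetilde X_a\varphi$ iff there is $j\ge i$ with $w[j]=a$, $w[k]\ne a$ for all $i\le k<j$, and $w,j\models\varphi$; $w,i\models\widetilde Y_a\varphi$ iff there is $j\le i$ with $w[j]=a$, $w[k]\ne a$ for all $j<k\le i$, and $w,j\models\varphi$;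 $w,i\models SP\,\varphi$ iff $w,1\models\varphi$; $w,i\models EP\,\varphi$ iff $w,|w|\models\varphi$; $w,i\models\bigcirc\varphi$ iff $i+1\in dom(w)$ and $w,i+1\models\varphi$; $w,i\models\ominus\varphi$ iff $i-1\in dom(w)$ and $w,i-1\models\varphi$. **The logic $TL^+[X_\varphi,Y_\varphi]$** has the formulas $\psi ::= a\mid\varphi\mid\psi\lor\psi\mid\neg\psi$ with $a\in A$, where $\varphi$ ranges over the *recursive rankers* $\varphi ::= \top\mid SP\,\varphi\mid EP\,\varphi\mid X_\psi\varphi\mid Y_\psi\varphi$ (a simultaneous definition). Here $w,i\models X_\psi\varphi$ iff there is $j>i$ with $w,j\models\psi$ and $w,j\models\varphi$, and $w,k\not\models\psi$ for all $i<k<j$; $w,i\models Y_\psi\varphi$ iff there is $j<i$ with $w,j\models\psi$ and $w,j\models\varphi$, and $w,k\not\models\psi$ for all $j<k<i$; the other clauses are as above. In both logics the language of a formula $\chi$ is $\mathcal L(\chi)=\{w\in A^+ \mid w,1\models\chi\}$. **The class $UL$.** A monomial is an expression $A_0^*a_1A_1^*\cdots a_nA_n^*$ with $n\ge 0$, $A_i\subseteq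 A$, $a_i\in A$. It is unambiguous if every word has at most one factorization $w=u_0a_1u_1\cdots a_nu_n$ with $u_i\in A_i^*$ for all $i$. $UL$ is the class of languages $L\subseteq A^*$ that are finite unions of pairwise disjoint languages of unambiguous monomials. **Lemma.** $TL^+[X_\varphi,Y_\varphi]\equiv TL[X_a,Y_a]$: a language is of the form $\mathcal L(\psi)$ for some formula $\psi$ of $TL^+[X_\varphi,Y_\varphi]$ if and only if it is of the form $\mathcal L(\varphi)$ for some formula $\varphi$ of $TL[X_a,Y_a]$. Moreover, these languages are exactly the languages $L\in UL$ with $L\subseteq A^+$. -/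

import Mathlib

universe u

/-! Words are lists over the alphabet `A`; a position of `w` is an element of `Fin w.length`
(counted from `0`). -/

/-- Formulas of the ranker logic `TL[X_a, Y_a]`. -/
inductive TLXY (A : Type u) : Type u
  | atom (a : A) : TLXY A
  | top : TLXY A
  | X (a : A) (φ : TLXY A) : TLXY A
  | Y (a : A) (φ : TLXY A) : TLXY A
  | SP (φ : TLXY A) : TLXY A
  | EP (φ : TLXY A) : TLXY A
  | or (φ₁ φ₂ : TLXY A) : TLXY A
  | neg (φ : TLXY A) : TLXY A
  | weakX (a : A) (φ : TLXY A) : TLXY A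
  | weakY (a : A) (φ : TLXY A) : TLXY A
  | next (φ : TLXY A) : TLXY A
  | prev (φ : TLXY A) : TLXY A

/-- `φ.Sat w i` is `w, i ⊨ φ`. -/
def TLXY.Sat {A : Type u} (w : List A) : TLXY A → Fin w.length → Prop
  | .atom a, i => w.get i = a
  | .top, _ => True
  | .X a φ, i => ∃ j, i < j ∧ w.get j = a ∧ (∀ k, i < k → k < j → w.get k ≠ a) ∧ φ.Sat w j
  | .Y a φ, i => ∃ j, j < i ∧ w.get j = a ∧ (∀ k, j < k → k < i → w.get k ≠ a) ∧ φ.Sat w j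
  | .SP φ, _ => ∃ j : Fin w.length, j.val = 0 ∧ φ.Sat w j
  | .EP φ, _ => ∃ j : Fin w.length, j.val + 1 = w.length ∧ φ.Sat w j
  | .or φ₁ φ₂, i => φ₁.Sat w i ∨ φ₂.Sat w i
  | .neg φ, i => ¬ φ.Sat w i
  | .weakX a φ, i => ∃ j, i ≤ j ∧ w.get j = a ∧ (∀ k, i ≤ k → k < j → w.get k ≠ a) ∧ φ.Sat w j
  | .weakY a φ, i => ∃ j, j ≤ i ∧ w.get j = a ∧ (∀ k, j < k → k ≤ i → w.get k ≠ a) ∧ φ.Sat w j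
  | .next φ, i => ∃ j : Fin w.length, j.val = i.val + 1 ∧ φ.Sat w j
  | .prev φ, i => ∃ j : Fin w.length, j.val + 1 = i.val ∧ φ.Sat w j

/-- The language of a formula: the (nonempty) words whose first position satisfies it. -/
def TLXY.language {A : Type u} (φ : TLXY A) : Language A :=
  {w : List A | ∃ i : Fin w.length, i.val = 0 ∧ φ.Sat w i}

mutual

/-- Recursive rankers `φ ::= ⊤ | SP φ | EP φ | X_ψ φ | Y_ψ φ`. -/
inductive RecRanker (A : Type u) : Type u
  | top : RecRanker A
  | SP (φ : RecRanker A) : RecRanker A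
  | EP (φ : RecRanker A) : RecRanker A
  | X (ψ : TLPlus A) (φ : RecRanker A) : RecRanker A
  | Y (ψ : TLPlus A) (φ : RecRanker A) : RecRanker A

/-- Formulas `ψ ::= a | φ | ψ ∨ ψ | ¬ ψ` of `TL⁺[X_φ, Y_φ]`, with `φ` a recursive ranker. -/
inductive TLPlus (A : Type u) : Type u
  | atom (a : A) : TLPlus A
  | ranker (φ : RecRanker A) : TLPlus A
  | or (ψ₁ ψ₂ : TLPlus A) : TLPlus A
  | neg (ψ : TLPlus A) : TLPlus A

end

mutual

/-- `φ.Sat w i` is `w, i ⊨ φ` for a recursive ranker `φ`. -/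
def RecRanker.Sat {A : Type u} (w : List A) : RecRanker A → Fin w.length → Prop
  | .top, _ => True
  | .SP φ, _ => ∃ j : Fin w.length, j.val = 0 ∧ φ.Sat w j
  | .EP φ, _ => ∃ j : Fin w.length, j.val + 1 = w.length ∧ φ.Sat w j
  | .X ψ φ, i => ∃ j, i < j ∧ (ψ.Sat w j ∧ φ.Sat w j) ∧ ∀ k, i < k → k < j → ¬ ψ.Sat w k
  | .Y ψ φ, i => ∃ j, j < i ∧ (ψ.Sat w j ∧ φ.Sat w j) ∧ ∀ k, j < k → k < i → ¬ ψ.Sat w k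

/-- `ψ.Sat w i` is `w, i ⊨ ψ` for a formula `ψ` of `TL⁺[X_φ, Y_φ]`. -/
def TLPlus.Sat {A : Type u} (w : List A) : TLPlus A → Fin w.length → Prop
  | .atom a, i => w.get i = a
  | .ranker φ, i => φ.Sat w i
  | .or ψ₁ ψ₂, i => ψ₁.Sat w i ∨ ψ₂.Sat w i
  | .neg ψ, i => ¬ ψ.Sat w i

end

/-- The language of a formula: the (nonempty) words whose first position satisfies it. -/
def TLPlus.language {A : Type u} (ψ : TLPlus A) : Language A :=
  {w : List A | ∃ i : Fin w.length, i.val = 0 ∧ ψ.Sat w i}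

/-- The languages definable in `TL[X_a, Y_a]`. -/
def tlxyLanguages (A : Type u) : Set (Language A) :=
  {L | ∃ φ : TLXY A, φ.language = L}

/-- The languages definable in `TL⁺[X_φ, Y_φ]`. -/
def tlPlusLanguages (A : Type u) : Set (Language A) :=
  {L | ∃ ψ : TLPlus A, ψ.language = L}

/-- The monomial `A₀* a₁ A₁* ⋯ aₙ Aₙ*`, with `head = A₀` and `tail = [(a₁, A₁), …, (aₙ, Aₙ)]`. -/
structure Monomial (A : Type u) : Type u where
  head : Set A
  tail : List (A × Set A)

/-- `(u₀, [u₁, …, uₙ])` is a parse of `w`: `uᵢ ∈ Aᵢ*` for all `i`, and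
`w = u₀ a₁ u₁ ⋯ aₙ uₙ`. -/
def Monomial.IsParse {A : Type u} (m : Monomial A) (w : List A)
    (p : List A × List (List A)) : Prop :=
  (∀ x ∈ p.1, x ∈ m.head) ∧
  List.Forall₂ (fun (c : A × Set A) (v : List A) => ∀ x ∈ v, x ∈ c.2) m.tail p.2 ∧
  w = p.1 ++ (List.zipWith (fun (c : A × Set A) (v : List A) => c.1 :: v) m.tail p.2).flatten

/-- The language of a monomial. -/
def Monomial.language {A : Type u} (m : Monomial A) : Language A :=
  {w : List A | ∃ p, m.IsParse w p}

/-- No word has two different parses. -/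
def Monomial.Unambiguous {A : Type u} (m : Monomial A) : Prop :=
  ∀ w p q, m.IsParse w p → m.IsParse w q → p = q

/-- The class `UL`: finite disjoint unions of (languages of) unambiguous monomials. -/
def unambiguousLanguages (A : Type u) : Set (Language A) :=
  {L | ∃ (n : ℕ) (m : Fin n → Monomial A),
    (∀ i, (m i).Unambiguous) ∧
    (∀ i j, i ≠ j → ∀ w, ¬ (w ∈ (m i).language ∧ w ∈ (m j).language)) ∧
    ∀ w, w ∈ L ↔ ∃ i, w ∈ (m i).language}

open Finset in
/-- The product of two series along the occurrences of the letter `a`. -/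
noncomputable def letterConv {A : Type u} (a : A) (f g : List A → ℕ) (w : List A) : ℕ :=
  open scoped Classical in
  ∑ i ∈ range w.length, if w[i]? = some a then f (w.take i) * g (w.drop (i + 1)) else 0

section LetterConv

variable {A : Type u} (a : A)

theorem letterConv_nil (f g : List A → ℕ) : letterConv a f g [] = 0 := by
  simp [letterConv]

open scoped Classical in
theorem letterConv_cons (f g : List A → ℕ) (x : A) (w : List A) :
    letterConv a f g (x :: w) =
      (if x = a then f [] * g w else 0) + letterConv a (fun u => f (x :: u)) g w := by
  simp [letterConv, Finset.sum_range_succ', add_comm]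

theorem letterConv_zero_left (g : List A → ℕ) (w : List A) :
    letterConv a (fun _ => 0) g w = 0 := by
  simp [letterConv]

theorem letterConv_zero_right (f : List A → ℕ) (w : List A) :
    letterConv a f (fun _ => 0) w = 0 := by
  simp [letterConv]

theorem letterConv_add_left (f f' g : List A → ℕ) (w : List A) :
    letterConv a (fun u => f u + f' u) g w = letterConv a f g w + letterConv a f' g w := by
  rw [letterConv, letterConv, letterConv, ← Finset.sum_add_distrib]
  refine Finset.sum_congr rfl fun i _ => ?_
  split_ifs <;> ring

theorem letterConv_add_right (f g g' : List A → ℕ) (w : List A) :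
    letterConv a f (fun v => g v + g' v) w = letterConv a f g w + letterConv a f g' w := by
  rw [letterConv, letterConv, letterConv, ← Finset.sum_add_distrib]
  refine Finset.sum_congr rfl fun i _ => ?_
  split_ifs <;> ring

end LetterConv

open scoped Classical in
/-- The number of parses of a word in the monomial with the given head and tail. -/
noncomputable def parseCount {A : Type u} : Set A → List (A × Set A) → List A → ℕ
  | _, [], [] => 1
  | _, _ :: _, [] => 0
  | H, [], x :: w => if x ∈ H then parseCount H [] w else 0
  | H, c :: t, x :: w =>
    (if x ∈ H then parseCount H (c :: t) w else 0) + if x = c.1 then parseCount c.2 t w else 0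

section ParseCount

variable {A : Type u}

open scoped Classical in
theorem parseCount_append_cons (a : A) (K : Set A) (s : List (A × Set A)) (w : List A) :
    ∀ (H : Set A) (t : List (A × Set A)),
      parseCount H (t ++ (a, K) :: s) w = letterConv a (parseCount H t) (parseCount K s) w := by
  induction w with
  | nil => intro H t; cases t <;> simp [parseCount, letterConv_nil]
  | cons x w ih =>
    intro H t
    cases t with
    | nil =>
      have := ih H []
      by_cases hx : x ∈ H
      · simp_all [parseCount, letterConv_cons, add_comm]
      · simp_all [parseCount, letterConv_cons, letterConv_zero_left]
    | cons c t =>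
      have h1 := ih H (c :: t)
      have h2 := ih c.2 t
      simp only [List.cons_append] at h1
      simp only [List.cons_append, parseCount, letterConv_cons, h1, h2, zero_mul, ite_self, zero_add,
        letterConv_add_left]
      congr 1
      · by_cases hx : x ∈ H <;> simp [hx, letterConv_zero_left]
      · by_cases hx : x = c.1 <;> simp [hx, letterConv_zero_left]

/-- The last set of the monomial with the given head and tail. -/
def lastSet : Set A → List (A × Set A) → Set A
  | H, [] => H
  | _, c :: t => lastSet c.2 t

open scoped Classical in
theorem parseCount_append (v : List A) (u : List A) :
    ∀ (H : Set A) (t : List (A × Set A)),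
      parseCount H t (u ++ v) = ∑ j ∈ Finset.range (t.length + 1),
        parseCount H (t.take j) u * parseCount (lastSet H (t.take j)) (t.drop j) v := by
  induction u with
  | nil =>
    intro H t
    rw [Finset.sum_range_succ']
    rw [Finset.sum_eq_zero]
    · simp [parseCount, lastSet]
    · intro j hj
      cases t with
      | nil => simp at hj
      | cons c t => simp [parseCount]
  | cons x u ih =>
    intro H t
    cases t with
    | nil =>
      have := ih H []
      by_cases hx : x ∈ H <;> simp_all [parseCount, lastSet]
    | cons c t =>
      have h1 := ih H (c :: t)
      have h2 := ih c.2 t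
      rw [Finset.sum_range_succ'] at h1 ⊢
      simp only [List.cons_append, List.take_succ_cons, List.drop_succ_cons, List.take_zero,
        List.drop_zero, List.length_cons, lastSet, parseCount] at h1 h2 ⊢
      rw [h1, h2]
      simp only [add_mul, Finset.sum_add_distrib]
      split_ifs <;> (try simp only [zero_mul, Finset.sum_const_zero, zero_add, add_zero]) <;> ring1

open scoped Classical in
/-- The tails of the monomials that make up the intersection of two monomials. -/
noncomputable def mergeTails :
    Set A → List (A × Set A) → Set A → List (A × Set A) → List (List (A × Set A))
  | _, [], _, [] => [[]]
  | _, c :: t, K, [] =>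
    if c.1 ∈ K then (mergeTails c.2 t K []).map (List.cons (c.1, c.2 ∩ K)) else []
  | H, [], _, d :: s =>
    if d.1 ∈ H then (mergeTails H [] d.2 s).map (List.cons (d.1, H ∩ d.2)) else []
  | H, c :: t, K, d :: s =>
    (if c.1 ∈ K then (mergeTails c.2 t K (d :: s)).map (List.cons (c.1, c.2 ∩ K)) else []) ++
    ((if d.1 ∈ H then (mergeTails H (c :: t) d.2 s).map (List.cons (d.1, H ∩ d.2)) else []) ++
    (if c.1 = d.1 then (mergeTails c.2 t d.2 s).map (List.cons (c.1, c.2 ∩ d.2)) else []))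
  termination_by _ t _ s => t.length + s.length

theorem sum_parseCount_map_cons_nil (G : Set A) (c : A × Set A) (l : List (List (A × Set A))) :
    ((l.map (List.cons c)).map fun r => parseCount G r []).sum = 0 := by
  induction l with
  | nil => simp
  | cons r l ih => simpa [parseCount] using ih

open scoped Classical in
theorem sum_parseCount_map_cons_cons (G : Set A) (c : A × Set A) (l : List (List (A × Set A)))
    (x : A) (w : List A) :
    ((l.map (List.cons c)).map fun r => parseCount G r (x :: w)).sum =
      (if x ∈ G then ((l.map (List.cons c)).map fun r => parseCount G r w).sum else 0) +
      if x = c.1 then (l.map fun r => parseCount c.2 r w).sum else 0 := by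
  induction l with
  | nil => simp
  | cons r l ih =>
    simp only [List.map_cons, List.sum_cons, ih, parseCount]
    split_ifs <;> ring

open scoped Classical in
theorem sum_parseCount_mergeTails (w : List A) :
    ∀ (H : Set A) (t : List (A × Set A)) (K : Set A) (s : List (A × Set A)),
      ((mergeTails H t K s).map fun r => parseCount (H ∩ K) r w).sum =
        parseCount H t w * parseCount K s w := by
  induction w with
  | nil =>
    intro H t K s
    rcases t with _ | ⟨c, t⟩ <;> rcases s with _ | ⟨d, s⟩ <;> rw [mergeTails] <;>
      (try split_ifs) <;> simp only [List.map_append, List.sum_append,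
        sum_parseCount_map_cons_nil, parseCount] <;> simp [parseCount]
  | cons x w ih =>
    intro H t K s
    have e := ih H t K s
    rcases t with _ | ⟨c, t⟩ <;> rcases s with _ | ⟨d, s⟩ <;> rw [mergeTails] at e ⊢
    · by_cases hH : x ∈ H <;> by_cases hK : x ∈ K <;> simp_all [parseCount]
    · have e1 := ih H [] d.2 s
      by_cases hd : d.1 ∈ H
      · rw [if_pos hd] at e ⊢
        rw [sum_parseCount_map_cons_cons, e, e1]
        simp only [parseCount, Set.mem_inter_iff]
        by_cases hH : x ∈ H <;> by_cases hK : x ∈ K <;> by_cases hx : x = d.1 <;>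
          simp_all <;> ring
      · rw [if_neg hd] at e ⊢
        by_cases hH : x ∈ H <;> by_cases hK : x ∈ K <;> by_cases hx : x = d.1 <;>
          simp_all [parseCount]
    · have e1 := ih c.2 t K []
      by_cases hd : c.1 ∈ K
      · rw [if_pos hd] at e ⊢
        rw [sum_parseCount_map_cons_cons, e, e1]
        simp only [parseCount, Set.mem_inter_iff]
        by_cases hH : x ∈ H <;> by_cases hK : x ∈ K <;> by_cases hx : x = c.1 <;>
          simp_all <;> ring
      · rw [if_neg hd] at e ⊢
        by_cases hH : x ∈ H <;> by_cases hK : x ∈ K <;> by_cases hx : x = c.1 <;>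
          simp_all [parseCount]
    · have e1 := ih c.2 t K (d :: s)
      have e2 := ih H (c :: t) d.2 s
      have e3 := ih c.2 t d.2 s
      simp only [List.map_append, List.sum_append] at e ⊢
      have k1 : ∀ (p : Prop) (l : List (List (A × Set A))) (y : List A) (G : Set A),
          (List.map (fun r => parseCount G r y) (if p then l else [])).sum =
            if p then (l.map fun r => parseCount G r y).sum else 0 := by
        intro p l y G; split_ifs <;> simp
      simp only [k1] at e ⊢
      simp only [sum_parseCount_map_cons_cons, e1, e2, e3, Set.mem_inter_iff]
      simp only [parseCount]
      by_cases hG : x ∈ H ∧ x ∈ K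
      · simp only [hG, and_self, if_true, add_mul, mul_add, ← e]
        obtain ⟨hH, hK⟩ := hG
        have a1 : x = c.1 → c.1 ∈ K := fun h => h ▸ hK
        have a2 : x = d.1 → d.1 ∈ H := fun h => h ▸ hH
        by_cases hc : x = c.1 <;> by_cases hd : x = d.1
        · have : c.1 = d.1 := hc ▸ hd
          simp only [a1 hc, a2 hd, if_pos hc, if_pos hd, if_true, if_pos this]; ring
        · have : ¬ c.1 = d.1 := hc ▸ hd
          simp only [a1 hc, if_pos hc, if_neg hd, if_true, if_neg this]; split_ifs <;> ring
        · have : ¬ c.1 = d.1 := hd ▸ fun h => hc h.symm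
          simp only [a2 hd, if_pos hd, if_neg hc, if_true, if_neg this]; split_ifs <;> ring
        · simp only [if_neg hc, if_neg hd]; split_ifs <;> ring
      · simp only [hG, if_false]
        by_cases hc : x = c.1
        · have a1 : c.1 ∈ K ↔ x ∈ K := by rw [hc]
          by_cases hd : x = d.1
          · have a2 : d.1 ∈ H ↔ x ∈ H := by rw [hd]
            have : c.1 = d.1 := hc ▸ hd
            simp only [if_pos hc, if_pos hd, if_pos this, a1, a2]
            split_ifs <;> first | ring1 | exact absurd ⟨‹x ∈ H›, ‹x ∈ K›⟩ hG
          · have : ¬ c.1 = d.1 := hc ▸ hd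
            simp only [if_pos hc, if_neg hd, if_neg this, a1]
            split_ifs <;> first | ring1 | exact absurd ⟨‹x ∈ H›, ‹x ∈ K›⟩ hG
        · by_cases hd : x = d.1
          · have a2 : d.1 ∈ H ↔ x ∈ H := by rw [hd]
            have : ¬ c.1 = d.1 := hd ▸ fun h => hc h.symm
            simp only [if_neg hc, if_pos hd, if_neg this, a2]
            split_ifs <;> first | ring1 | exact absurd ⟨‹x ∈ H›, ‹x ∈ K›⟩ hG
          · simp only [if_neg hc, if_neg hd]
            split_ifs <;> first | ring1 | exact absurd ⟨‹x ∈ H›, ‹x ∈ K›⟩ hG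

end ParseCount

/-- Sums of the parse-counting series of monomials. -/
inductive MonomialSeries {A : Type u} : (List A → ℕ) → Prop
  | zero : MonomialSeries fun _ => 0
  | count (H : Set A) (t : List (A × Set A)) : MonomialSeries (parseCount H t)
  | add {f g : List A → ℕ} : MonomialSeries f → MonomialSeries g →
      MonomialSeries fun w => f w + g w

namespace MonomialSeries

variable {A : Type u} {f g : List A → ℕ}

theorem sum_map {ι : Type*} (l : List ι) (F : ι → List A → ℕ) (h : ∀ i, MonomialSeries (F i)) :
    MonomialSeries fun w => (l.map fun i => F i w).sum := by
  induction l with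
  | nil => exact zero
  | cons i l ih => simpa using (h i).add ih

theorem mul (hf : MonomialSeries f) (hg : MonomialSeries g) :
    MonomialSeries fun w => f w * g w := by
  induction hf with
  | zero => simpa using zero
  | add _ _ h1 h2 => simpa only [add_mul] using h1.add h2
  | count H t =>
    induction hg with
    | zero => simpa using zero
    | add _ _ h1 h2 => simpa only [mul_add] using h1.add h2
    | count K s =>
      simpa only [← sum_parseCount_mergeTails] using
        sum_map (mergeTails H t K s) (fun r => parseCount (H ∩ K) r) fun r => count _ r

theorem letterConv (a : A) (hf : MonomialSeries f) (hg : MonomialSeries g) :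
    MonomialSeries (letterConv a f g) := by
  induction hf with
  | zero => simpa only [funext (letterConv_zero_left a g)] using zero
  | add _ _ h1 h2 => rw [funext (letterConv_add_left a _ _ g)]; exact h1.add h2
  | count H t =>
    induction hg with
    | zero => simpa only [funext (letterConv_zero_right a _)] using zero
    | add _ _ h1 h2 => rw [funext (letterConv_add_right a _ _ _)]; exact h1.add h2
    | count K s =>
      rw [← funext fun w => parseCount_append_cons a K s w H t]
      exact count _ _

theorem exists_list (hf : MonomialSeries f) : ∃ l : List (Monomial A),
    ∀ w, f w = (l.map fun m => parseCount m.head m.tail w).sum := by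
  induction hf with
  | zero => exact ⟨[], by simp⟩
  | count H t => exact ⟨[⟨H, t⟩], by simp⟩
  | add _ _ h1 h2 =>
    obtain ⟨l1, h1⟩ := h1
    obtain ⟨l2, h2⟩ := h2
    exact ⟨l1 ++ l2, by simp [h1, h2]⟩

end MonomialSeries

section Parses

variable {A : Type u}

open scoped Classical in
/-- The list of all parses of a word in the monomial with the given head and tail. -/
noncomputable def parseList :
    Set A → List (A × Set A) → List A → List (List A × List (List A))
  | _, [], [] => [([], [])]
  | _, _ :: _, [] => []
  | H, [], x :: w => if x ∈ H then (parseList H [] w).map fun p => (x :: p.1, p.2) else []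
  | H, c :: t, x :: w =>
    (if x ∈ H then (parseList H (c :: t) w).map fun p => (x :: p.1, p.2) else []) ++
    if x = c.1 then (parseList c.2 t w).map fun p => ([], p.1 :: p.2) else []

theorem length_parseList (w : List A) : ∀ (H : Set A) (t : List (A × Set A)),
    (parseList H t w).length = parseCount H t w := by
  induction w with
  | nil => intro H t; cases t <;> simp [parseList, parseCount]
  | cons x w ih =>
    intro H t
    cases t with
    | nil => simp only [parseList, parseCount, ← ih H []]; split_ifs <;> simp
    | cons c t =>
      simp only [parseList, parseCount, ← ih H (c :: t), ← ih c.2 t]; split_ifs <;> simp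

theorem nodup_parseList (w : List A) : ∀ (H : Set A) (t : List (A × Set A)),
    (parseList H t w).Nodup := by
  have inj1 : ∀ x : A, Function.Injective
      fun p : List A × List (List A) => (x :: p.1, p.2) := by
    rintro x ⟨p, q⟩ ⟨p', q'⟩ h; simpa using h
  have inj2 : Function.Injective
      fun p : List A × List (List A) => (([] : List A), p.1 :: p.2) := by
    rintro ⟨p, q⟩ ⟨p', q'⟩ h; simpa using h
  induction w with
  | nil => intro H t; cases t <;> simp [parseList]
  | cons x w ih =>
    intro H t
    cases t with
    | nil =>
      simp only [parseList]
      split_ifs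
      · exact (ih H []).map (inj1 x)
      · exact List.nodup_nil
    | cons c t =>
      simp only [parseList]
      refine List.Nodup.append ?_ ?_ ?_
      · split_ifs
        · exact (ih H (c :: t)).map (inj1 x)
        · exact List.nodup_nil
      · split_ifs
        · exact (ih c.2 t).map inj2
        · exact List.nodup_nil
      · split_ifs <;> simp [List.disjoint_left]
        grind

theorem mem_parseList (w : List A) : ∀ (H : Set A) (t : List (A × Set A))
    (p : List A × List (List A)),
    p ∈ parseList H t w ↔ (Monomial.mk H t).IsParse w p := by
  induction w with
  | nil =>
    rintro H t ⟨u, l⟩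
    cases t with
    | nil => cases l <;> simp [parseList, Monomial.IsParse]; rintro rfl; simp
    | cons c t => cases l <;> simp [parseList, Monomial.IsParse]
  | cons x w ih =>
    rintro H t ⟨u, l⟩
    cases t with
    | nil =>
      have ih := ih H []
      cases u with
      | nil => simp only [parseList]; split_ifs <;> cases l <;> simp [Monomial.IsParse]
      | cons y u =>
        simp only [parseList]
        split_ifs with h
        · simp only [List.mem_map, ih, Prod.exists, Prod.mk.injEq, List.cons.injEq,
            Monomial.IsParse]
          cases l <;> simp <;> grind
        · cases l <;> simp [Monomial.IsParse]; grind
    | cons c t =>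
      have ih1 := ih H (c :: t)
      have ih2 := ih c.2 t
      have k : ∀ (P : Prop) [Decidable P] (l : List (List A × List (List A))) (q : List A × List (List A)),
          (q ∈ if P then l else []) ↔ P ∧ q ∈ l := by
        intro P _ l q; split_ifs with h <;> simp [h]
      simp only [parseList, List.mem_append, k, List.mem_map, ih1, ih2]
      simp only [Prod.exists, Prod.mk.injEq, Monomial.IsParse]
      cases l with
      | nil => simp
      | cons v l =>
        cases u with
        | nil => simp; grind
        | cons y u => simp; grind

end Parses

namespace Monomial

variable {A : Type u} (m : Monomial A)

theorem mem_language_iff (w : List A) :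
    w ∈ m.language ↔ parseCount m.head m.tail w ≠ 0 := by
  rw [← length_parseList, Ne, List.length_eq_zero_iff, List.eq_nil_iff_forall_not_mem]
  simp only [mem_parseList, not_forall, not_not]
  rfl

theorem unambiguous_iff : m.Unambiguous ↔ ∀ w, parseCount m.head m.tail w ≤ 1 := by
  simp only [← length_parseList, Unambiguous]
  refine forall_congr' fun w => ?_
  have h := nodup_parseList w m.head m.tail
  have k := mem_parseList w m.head m.tail
  constructor
  · intro hw
    by_contra! hl
    have e := hw _ _ ((k _).1 (List.getElem_mem (n := 0) (by omega)))
      ((k _).1 (List.getElem_mem (n := 1) (by omega)))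
    have := (h.getElem_inj_iff).1 e
    omega
  · intro hl p q hp hq
    obtain ⟨i, hi, rfl⟩ := List.getElem_of_mem ((k p).2 hp)
    obtain ⟨j, hj, rfl⟩ := List.getElem_of_mem ((k q).2 hq)
    congr 1
    omega

end Monomial

open scoped Classical in
/-- The characteristic series of a set of words. -/
noncomputable def charSeries {A : Type u} (L : Set (List A)) (w : List A) : ℕ :=
  if w ∈ L then 1 else 0

theorem charSeries_of_mem {A : Type u} {L : Set (List A)} {w : List A} (h : w ∈ L) :
    charSeries L w = 1 := if_pos h

theorem charSeries_of_notMem {A : Type u} {L : Set (List A)} {w : List A} (h : w ∉ L) :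
    charSeries L w = 0 := if_neg h

open scoped Classical in
theorem mem_unambiguousLanguages_iff {A : Type u} (L : Language A) :
    L ∈ unambiguousLanguages A ↔ MonomialSeries (charSeries (L : Set (List A))) := by
  constructor
  · rintro ⟨n, m, hm, hd, hL⟩
    convert MonomialSeries.sum_map (List.finRange n)
      (fun i => parseCount (m i).head (m i).tail) (fun i => .count _ _) using 1
    funext w
    rw [← List.ofFn_eq_map, List.sum_ofFn]
    by_cases hw : w ∈ L
    · obtain ⟨i, hi⟩ := (hL w).1 hw
      have h1 := ((m i).mem_language_iff w).1 hi
      have h2 := (m i).unambiguous_iff.1 (hm i) w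
      rw [Finset.sum_eq_single i]
      · rw [charSeries_of_mem hw]; omega
      · intro j _ hj
        by_contra h
        exact hd j i hj w ⟨((m j).mem_language_iff w).2 h, hi⟩
      · simp
    · rw [charSeries_of_notMem hw, eq_comm, Finset.sum_eq_zero]
      intro i _
      by_contra h
      exact hw ((hL w).2 ⟨i, ((m i).mem_language_iff w).2 h⟩)
  · intro h
    obtain ⟨l, hl⟩ := h.exists_list
    have hs : ∀ w, ∑ i : Fin l.length, parseCount l[i].head l[i].tail w =
        charSeries (L : Set (List A)) w := by
      intro w
      rw [hl w, ← List.sum_ofFn]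
      congr 1
      exact List.ext_getElem (by simp) (by simp)
    have h1 : ∀ w, charSeries (L : Set (List A)) w ≤ 1 := by
      intro w; unfold charSeries; split_ifs <;> simp
    refine ⟨l.length, fun i => l[i], ?_, ?_, ?_⟩
    · intro i
      rw [Monomial.unambiguous_iff]
      intro w
      refine le_trans ?_ ((hs w).le.trans (h1 w))
      exact Finset.single_le_sum (f := fun i : Fin l.length => parseCount l[i].head l[i].tail w)
        (fun _ _ => Nat.zero_le _) (Finset.mem_univ i)
    · rintro i j hij w ⟨hi, hj⟩
      rw [Monomial.mem_language_iff] at hi hj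
      dsimp only at hi hj
      have := Finset.add_le_sum
        (f := fun i : Fin l.length => parseCount l[i].head l[i].tail w)
        (fun _ _ => Nat.zero_le _) (Finset.mem_univ i) (Finset.mem_univ j) hij
      have := h1 w
      have := hs w
      omega
    · intro w
      have e := hs w
      constructor
      · intro hw
        rw [charSeries_of_mem hw] at e
        obtain ⟨i, -, hi⟩ := Finset.exists_ne_zero_of_sum_ne_zero (e.trans_ne one_ne_zero)
        exact ⟨i, (Monomial.mem_language_iff _ w).2 hi⟩
      · rintro ⟨i, hi⟩
        rw [Monomial.mem_language_iff] at hi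
        by_contra hw
        rw [charSeries_of_notMem hw] at e
        exact hi (Finset.sum_eq_zero_iff.1 e i (Finset.mem_univ i))

section Factor

variable {A : Type u} {a : A}

open scoped Classical in
/-- The factorization of a word at the first occurrence of `a`. -/
noncomputable def firstFactor (a : A) : List A → Option (List A × List A)
  | [] => none
  | x :: w => if x = a then some ([], w) else (firstFactor a w).map fun p => (x :: p.1, p.2)

open scoped Classical in
/-- The factorization of a word at the last occurrence of `a`. -/
noncomputable def lastFactor (a : A) : List A → Option (List A × List A)
  | [] => none
  | x :: w => match lastFactor a w with
    | some p => some (x :: p.1, p.2)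
    | none => if x = a then some ([], w) else none

theorem firstFactor_eq_none {w : List A} : firstFactor a w = none ↔ a ∉ w := by
  induction w with
  | nil => simp [firstFactor]
  | cons x w ih =>
    simp only [firstFactor]
    split_ifs with h
    · simp [h]
    · simp [ih, Ne.symm h]

theorem firstFactor_eq_some {w u v : List A} :
    firstFactor a w = some (u, v) ↔ w = u ++ a :: v ∧ a ∉ u := by
  induction w generalizing u with
  | nil => simp [firstFactor]
  | cons x w ih =>
    simp only [firstFactor]
    cases u with
    | nil => split_ifs with h <;> simp [h]
    | cons y u =>
      split_ifs with h
      · simp [h]; rintro rfl; simp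
      · simp only [Option.map_eq_some_iff, Prod.exists, Prod.mk.injEq, List.cons.injEq]
        grind

theorem lastFactor_eq_none {w : List A} : lastFactor a w = none ↔ a ∉ w := by
  induction w with
  | nil => simp [lastFactor]
  | cons x w ih =>
    simp only [lastFactor]
    cases hw : lastFactor a w with
    | some p =>
      have : a ∈ w := by
        by_contra h; simp [ih.2 h] at hw
      simp [this]
    | none =>
      have := ih.1 hw
      split_ifs with h
      · simp [h]
      · simp [this, Ne.symm h]

theorem lastFactor_eq_some {w u v : List A} :
    lastFactor a w = some (u, v) ↔ w = u ++ a :: v ∧ a ∉ v := by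
  induction w generalizing u v with
  | nil => simp [lastFactor]
  | cons x w ih =>
    simp only [lastFactor]
    cases hw : lastFactor a w with
    | some p =>
      obtain ⟨p, q⟩ := p
      obtain ⟨rfl, hq⟩ := ih.1 hw
      cases u with
      | nil =>
        simp only [Option.some.injEq, Prod.mk.injEq, List.nil_append, List.cons.injEq]
        constructor
        · simp
        · rintro ⟨⟨rfl, rfl⟩, h⟩; simp at h
      | cons y u =>
        have := @ih u v
        rw [hw] at this
        simp only [Option.some.injEq, Prod.mk.injEq, List.cons.injEq, List.cons_append] at this ⊢
        tauto
    | none =>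
      have ha := lastFactor_eq_none.1 hw
      cases u with
      | nil => split_ifs with h <;> simp [h]; rintro rfl; exact ha
      | cons y u =>
        split_ifs with h <;> simp <;> rintro rfl rfl <;> simp at ha

theorem append_cons_inj_of_notMem_left {u u' v v' : List A} (h : u ++ a :: v = u' ++ a :: v')
    (hu : a ∉ u) (hu' : a ∉ u') : u = u' ∧ v = v' := by
  have h1 : firstFactor a (u ++ a :: v) = some (u, v) := firstFactor_eq_some.2 ⟨rfl, hu⟩
  have h2 := firstFactor_eq_some.2 ⟨h, hu'⟩
  simpa [h1] using h2

theorem append_cons_inj_of_notMem_right {u u' v v' : List A} (h : u ++ a :: v = u' ++ a :: v')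
    (hv : a ∉ v) (hv' : a ∉ v') : u = u' ∧ v = v' := by
  have h1 : lastFactor a (u ++ a :: v) = some (u, v) := lastFactor_eq_some.2 ⟨rfl, hv⟩
  have h2 := lastFactor_eq_some.2 ⟨h, hv'⟩
  simpa [h1] using h2

theorem exists_first_factor {w : List A} (h : a ∈ w) : ∃ u v, w = u ++ a :: v ∧ a ∉ u := by
  cases hw : firstFactor a w with
  | none => exact absurd h (firstFactor_eq_none.1 hw)
  | some p => exact ⟨p.1, p.2, firstFactor_eq_some.1 hw⟩

theorem exists_last_factor {w : List A} (h : a ∈ w) : ∃ u v, w = u ++ a :: v ∧ a ∉ v := by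
  cases hw : lastFactor a w with
  | none => exact absurd h (lastFactor_eq_none.1 hw)
  | some p => exact ⟨p.1, p.2, lastFactor_eq_some.1 hw⟩

end Factor

section Profile

/-- The values of the depth-`n` profile. -/
def Profile (A : Type u) : ℕ → Type u
  | 0 => PUnit
  | n + 1 => (A → Option (Profile A n × Profile A n)) × (A → Option (Profile A n × Profile A n))

instance Profile.instFinite {A : Type u} [Finite A] : ∀ n, Finite (Profile A n)
  | 0 => inferInstanceAs (Finite PUnit)
  | n + 1 =>
    have := Profile.instFinite (A := A) n
    inferInstanceAs (Finite ((A → Option (Profile A n × Profile A n)) ×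
      (A → Option (Profile A n × Profile A n))))

variable {A : Type u}

/-- The depth-`n` profile of a word: for every letter, the profiles of smaller depth of the two
parts of the word before and after its first (last) occurrence. -/
noncomputable def profile : ∀ n, List A → Profile A n
  | 0, _ => PUnit.unit
  | n + 1, w => (fun a => (firstFactor a w).map (Prod.map (profile n) (profile n)),
      fun a => (lastFactor a w).map (Prod.map (profile n) (profile n)))

theorem profile_first {n : ℕ} {a : A} {u v w : List A}
    (h : profile (n + 1) (u ++ a :: v) = profile (n + 1) w) (hu : a ∉ u) :
    ∃ u' v', w = u' ++ a :: v' ∧ a ∉ u' ∧ profile n u = profile n u' ∧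
      profile n v = profile n v' := by
  have h1 := congrFun (congrArg Prod.fst h) a
  simp only [profile, firstFactor_eq_some.2 ⟨rfl, hu⟩, Option.map_some] at h1
  obtain ⟨⟨u', v'⟩, e1, e2⟩ := Option.map_eq_some_iff.1 h1.symm
  obtain ⟨rfl, hu'⟩ := firstFactor_eq_some.1 e1
  rw [Prod.map_apply, Prod.mk.injEq] at e2
  exact ⟨u', v', rfl, hu', e2.1.symm, e2.2.symm⟩

theorem profile_last {n : ℕ} {a : A} {u v w : List A}
    (h : profile (n + 1) (u ++ a :: v) = profile (n + 1) w) (hv : a ∉ v) :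
    ∃ u' v', w = u' ++ a :: v' ∧ a ∉ v' ∧ profile n u = profile n u' ∧
      profile n v = profile n v' := by
  have h1 := congrFun (congrArg Prod.snd h) a
  simp only [profile, lastFactor_eq_some.2 ⟨rfl, hv⟩, Option.map_some] at h1
  obtain ⟨⟨u', v'⟩, e1, e2⟩ := Option.map_eq_some_iff.1 h1.symm
  obtain ⟨rfl, hu'⟩ := lastFactor_eq_some.1 e1
  rw [Prod.map_apply, Prod.mk.injEq] at e2
  exact ⟨u', v', rfl, hu', e2.1.symm, e2.2.symm⟩

/-- The factorizations of `w` at first and last occurrences are matched by those of `w'`. -/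
def ProfileLE (n : ℕ) (w w' : List A) : Prop :=
  (∀ a u v, w = u ++ a :: v → a ∉ u → ∃ u' v', w' = u' ++ a :: v' ∧ a ∉ u' ∧
      profile n u = profile n u' ∧ profile n v = profile n v') ∧
  (∀ a u v, w = u ++ a :: v → a ∉ v → ∃ u' v', w' = u' ++ a :: v' ∧ a ∉ v' ∧
      profile n u = profile n u' ∧ profile n v = profile n v')

theorem ProfileLE.of_eq {n : ℕ} {w w' : List A} (h : profile (n + 1) w = profile (n + 1) w') :
    ProfileLE n w w' :=
  ⟨by rintro a u v rfl hu; exact profile_first h hu,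
    by rintro a u v rfl hu; exact profile_last h hu⟩

theorem ProfileLE.antisymm {n : ℕ} {w w' : List A} (h : ProfileLE n w w')
    (h' : ProfileLE n w' w) : profile (n + 1) w = profile (n + 1) w' := by
  refine Prod.ext (funext fun a => ?_) (funext fun a => ?_)
  · simp only [profile]
    cases hw : firstFactor a w with
    | some p =>
      obtain ⟨e, hu⟩ := firstFactor_eq_some.1 hw
      obtain ⟨u', v', rfl, hu', e1, e2⟩ := h.1 a _ _ e hu
      rw [firstFactor_eq_some.2 ⟨rfl, hu'⟩]
      simp [Prod.map, e1, e2]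
    | none =>
      have hw1 := firstFactor_eq_none.1 hw
      rw [firstFactor_eq_none.2]
      intro hw2
      obtain ⟨u, v, rfl, hu⟩ := exists_first_factor hw2
      obtain ⟨u', v', rfl, -⟩ := h'.1 a _ _ rfl hu
      simp at hw1
  · simp only [profile]
    cases hw : lastFactor a w with
    | some p =>
      obtain ⟨e, hu⟩ := lastFactor_eq_some.1 hw
      obtain ⟨u', v', rfl, hu', e1, e2⟩ := h.2 a _ _ e hu
      rw [lastFactor_eq_some.2 ⟨rfl, hu'⟩]
      simp [Prod.map, e1, e2]
    | none =>
      have hw1 := lastFactor_eq_none.1 hw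
      rw [lastFactor_eq_none.2]
      intro hw2
      obtain ⟨u, v, rfl, hu⟩ := exists_last_factor hw2
      obtain ⟨u', v', rfl, -⟩ := h'.2 a _ _ rfl hu
      simp at hw1

theorem profile_of_succ : ∀ {n : ℕ} {w w' : List A},
    profile (n + 1) w = profile (n + 1) w' → profile n w = profile n w' := by
  intro n
  induction n with
  | zero => intro w w' _; rfl
  | succ n ih =>
    have key : ∀ w w' : List A, profile (n + 1 + 1) w = profile (n + 1 + 1) w' →
        ProfileLE n w w' := by
      intro w w' h
      have := ProfileLE.of_eq h
      refine ⟨fun a u v e hu => ?_, fun a u v e hu => ?_⟩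
      · obtain ⟨u', v', e', hu', e1, e2⟩ := this.1 a u v e hu
        exact ⟨u', v', e', hu', ih e1, ih e2⟩
      · obtain ⟨u', v', e', hu', e1, e2⟩ := this.2 a u v e hu
        exact ⟨u', v', e', hu', ih e1, ih e2⟩
    intro w w' h
    exact (key w w' h).antisymm (key w' w h.symm)

theorem profile_mono {m n : ℕ} (hmn : m ≤ n) {w w' : List A} (h : profile n w = profile n w') :
    profile m w = profile m w' := by
  induction n, hmn using Nat.le_induction with
  | base => exact h
  | succ n _ ih => exact ih (profile_of_succ h)

theorem profile_append : ∀ {n : ℕ} {u u' v v' : List A},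
    profile n u = profile n u' → profile n v = profile n v' →
      profile n (u ++ v) = profile n (u' ++ v') := by
  intro n
  induction n with
  | zero => intros; rfl
  | succ n ih =>
    have key : ∀ u u' v v' : List A, profile (n + 1) u = profile (n + 1) u' →
        profile (n + 1) v = profile (n + 1) v' → ProfileLE n (u ++ v) (u' ++ v') := by
      intro u u' v v' hu hv
      refine ⟨fun a x y e hx => ?_, fun a x y e hy => ?_⟩
      · by_cases ha : a ∈ u
        · obtain ⟨p, q, rfl, hp⟩ := exists_first_factor ha
          obtain ⟨p', q', rfl, hp', e1, e2⟩ := profile_first hu hp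
          obtain ⟨rfl, rfl⟩ := append_cons_inj_of_notMem_left
            (by rw [← e]; simp : x ++ a :: y = p ++ a :: (q ++ v)) hx hp
          exact ⟨p', q' ++ v', by simp, hp', e1, ih e2 (profile_of_succ hv)⟩
        · have hav : a ∈ v := by
            have : a ∈ u ++ v := by rw [e]; simp
            simpa [ha] using this
          obtain ⟨p, q, rfl, hp⟩ := exists_first_factor hav
          obtain ⟨p', q', rfl, hp', e1, e2⟩ := profile_first hv hp
          obtain ⟨rfl, rfl⟩ := append_cons_inj_of_notMem_left
            (by rw [← e]; simp : x ++ a :: y = (u ++ p) ++ a :: q) hx (by simp [ha, hp])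
          have ha' : a ∉ u' := by
            intro h
            obtain ⟨r, s, rfl, hr⟩ := exists_first_factor h
            obtain ⟨_, _, rfl, -⟩ := profile_first hu.symm hr
            simp at ha
          exact ⟨u' ++ p', q', by simp, by simp [ha', hp'], ih (profile_of_succ hu) e1, e2⟩
      · by_cases ha : a ∈ v
        · obtain ⟨p, q, rfl, hp⟩ := exists_last_factor ha
          obtain ⟨p', q', rfl, hp', e1, e2⟩ := profile_last hv hp
          obtain ⟨rfl, rfl⟩ := append_cons_inj_of_notMem_right
            (by rw [← e]; simp : x ++ a :: y = (u ++ p) ++ a :: q) hy hp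
          exact ⟨u' ++ p', q', by simp, hp', ih (profile_of_succ hu) e1, e2⟩
        · have hau : a ∈ u := by
            have : a ∈ u ++ v := by rw [e]; simp
            simpa [ha] using this
          obtain ⟨p, q, rfl, hp⟩ := exists_last_factor hau
          obtain ⟨p', q', rfl, hp', e1, e2⟩ := profile_last hu hp
          obtain ⟨rfl, rfl⟩ := append_cons_inj_of_notMem_right
            (by rw [← e]; simp : x ++ a :: y = p ++ a :: (q ++ v)) hy (by simp [ha, hp])
          have ha' : a ∉ v' := by
            intro h
            obtain ⟨r, s, rfl, hr⟩ := exists_first_factor h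
            obtain ⟨_, _, rfl, -⟩ := profile_first hv.symm hr
            simp at ha
          exact ⟨p', q' ++ v', by simp, by simp [ha', hp'], e1, ih e2 (profile_of_succ hv)⟩
    intro u u' v v' hu hv
    exact (key u u' v v' hu hv).antisymm (key u' u v' v hu.symm hv.symm)

theorem profile_cons {n : ℕ} {v v' : List A} (a : A) (h : profile n v = profile n v') :
    profile n (a :: v) = profile n (a :: v') :=
  profile_append (u := [a]) rfl h

theorem mem_of_profile {n : ℕ} {w w' : List A} (h : profile (n + 1) w = profile (n + 1) w')
    {a : A} (ha : a ∈ w) : a ∈ w' := by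
  obtain ⟨r, s, rfl, hr⟩ := exists_first_factor ha
  obtain ⟨_, _, rfl, -⟩ := profile_first h hr
  simp

theorem eq_nil_of_profile {n : ℕ} {w : List A} (h : profile (n + 1) [] = profile (n + 1) w) :
    w = [] := by
  rw [List.eq_nil_iff_forall_not_mem]
  intro a ha
  simpa using mem_of_profile h.symm ha

/-- `L` is a union of classes of words with the same depth-`n` profile. -/
def ProfileClosed (n : ℕ) (L : Set (List A)) : Prop :=
  ∀ w w', profile n w = profile n w' → w ∈ L → w' ∈ L

theorem ProfileClosed.mono {m n : ℕ} (hmn : m ≤ n) {L : Set (List A)} (h : ProfileClosed m L) :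
    ProfileClosed n L := fun w w' e => h w w' (profile_mono hmn e)

end Profile

/-- Sets of words built by Boolean operations and deterministic products. -/
inductive DetSet {A : Type u} : Set (List A) → Prop
  | univ : DetSet Set.univ
  | avoid (a : A) : DetSet {w | a ∉ w}
  | compl {L : Set (List A)} : DetSet L → DetSet Lᶜ
  | union {L L' : Set (List A)} : DetSet L → DetSet L' → DetSet (L ∪ L')
  | left (a : A) {L L' : Set (List A)} : DetSet L → DetSet L' →
      DetSet {w | ∃ u v, w = u ++ a :: v ∧ a ∉ u ∧ u ∈ L ∧ v ∈ L'}
  | right (a : A) {L L' : Set (List A)} : DetSet L → DetSet L' →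
      DetSet {w | ∃ u v, w = u ++ a :: v ∧ a ∉ v ∧ u ∈ L ∧ v ∈ L'}

namespace DetSet

variable {A : Type u}

theorem iUnion {ι : Type*} [Finite ι] {L : ι → Set (List A)} (h : ∀ i, DetSet (L i)) :
    DetSet (⋃ i, L i) := by
  classical
  have := Fintype.ofFinite ι
  suffices ∀ s : Finset ι, DetSet (⋃ i ∈ s, L i) by simpa using this Finset.univ
  intro s
  induction s using Finset.induction_on with
  | empty => simpa using univ.compl
  | insert i s _ ih => simpa using (h i).union ih

theorem inter {L L' : Set (List A)} (h : DetSet L) (h' : DetSet L') : DetSet (L ∩ L') := by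
  simpa [Set.compl_union] using (h.compl.union h'.compl).compl

theorem iInter {ι : Type*} [Finite ι] {L : ι → Set (List A)} (h : ∀ i, DetSet (L i)) :
    DetSet (⋂ i, L i) := by
  simpa [Set.compl_iUnion] using (iUnion fun i => (h i).compl).compl

theorem setOf_profile_eq [Finite A] : ∀ (n : ℕ) (w : List A),
    DetSet {w' | profile n w' = profile n w} := by
  intro n
  induction n with
  | zero =>
    intro w
    convert univ using 1
    exact Set.eq_univ_of_forall fun _ => rfl
  | succ n ih =>
    intro w
    have h1 : ∀ a, DetSet {w' | (firstFactor a w').map (Prod.map (profile n) (profile n)) =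
        (firstFactor a w).map (Prod.map (profile n) (profile n))} := by
      intro a
      cases hw : firstFactor a w with
      | none => simpa [firstFactor_eq_none] using avoid a
      | some p =>
        convert left a (ih p.1) (ih p.2) using 1
        ext w'
        simp [firstFactor_eq_some, Prod.map, Prod.ext_iff, and_assoc]
    have h2 : ∀ a, DetSet {w' | (lastFactor a w').map (Prod.map (profile n) (profile n)) =
        (lastFactor a w).map (Prod.map (profile n) (profile n))} := by
      intro a
      cases hw : lastFactor a w with
      | none => simpa [lastFactor_eq_none] using avoid a
      | some p =>
        convert right a (ih p.1) (ih p.2) using 1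
        ext w'
        simp [lastFactor_eq_some, Prod.map, Prod.ext_iff, and_assoc]
    convert (iInter h1).inter (iInter h2) using 1
    ext w'
    simp only [profile, Set.mem_ofPred_eq, Set.mem_inter_iff, Set.mem_iInter]
    refine Prod.ext_iff.trans ?_
    simp only [funext_iff]

theorem of_profileClosed [Finite A] {n : ℕ} {L : Set (List A)} (h : ProfileClosed n L) :
    DetSet L := by
  have e : L = ⋃ p : profile n '' L, {w | profile n w = p} := by
    ext w
    simp only [Set.mem_iUnion, Set.mem_ofPred_eq, Subtype.exists, exists_prop, exists_eq_right',
      Set.mem_image]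
    constructor
    · intro hw; exact ⟨w, hw, rfl⟩
    · rintro ⟨w', hw', e⟩; exact h _ _ e hw'
  rw [e]
  refine iUnion ?_
  rintro ⟨_, w, -, rfl⟩
  exact setOf_profile_eq n w

end DetSet

section SeriesSet

variable {A : Type u} {L K : Set (List A)}

/-- Sets of words whose characteristic series is a sum of parse-counting series. -/
def SeriesSet (L : Set (List A)) : Prop := MonomialSeries (charSeries L)

theorem SeriesSet.inter (hL : SeriesSet L) (hK : SeriesSet K) : SeriesSet (L ∩ K) := by
  unfold SeriesSet
  convert MonomialSeries.mul hL hK using 1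
  funext w
  by_cases h1 : w ∈ L <;> by_cases h2 : w ∈ K <;> simp [charSeries, h1, h2]

theorem SeriesSet.union_of_disjoint (hL : SeriesSet L) (hK : SeriesSet K)
    (h : ∀ w, w ∈ L → w ∉ K) : SeriesSet (L ∪ K) := by
  unfold SeriesSet
  convert MonomialSeries.add hL hK using 1
  funext w
  have := h w
  by_cases h1 : w ∈ L <;> by_cases h2 : w ∈ K <;> simp_all [charSeries]

theorem seriesSet_setOf_forall_mem (B : Set A) : SeriesSet {w : List A | ∀ x ∈ w, x ∈ B} := by
  unfold SeriesSet
  convert MonomialSeries.count B [] using 1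
  funext w
  induction w with
  | nil => simp [charSeries, parseCount]
  | cons x w ih =>
    rw [parseCount, ← ih]
    split_ifs with h
    · have : x :: w ∈ {w : List A | ∀ x ∈ w, x ∈ B} ↔ w ∈ {w : List A | ∀ x ∈ w, x ∈ B} := by
        simp [h]
      by_cases hw : w ∈ {w : List A | ∀ x ∈ w, x ∈ B}
      · rw [charSeries_of_mem hw, charSeries_of_mem (this.2 hw)]
      · rw [charSeries_of_notMem hw, charSeries_of_notMem fun h => hw (this.1 h)]
    · exact charSeries_of_notMem fun hw => h (hw x (by simp))

theorem SeriesSet.product (a : A) (hL : SeriesSet L) (hK : SeriesSet K)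
    (h : ∀ u v u' v', u ++ a :: v = u' ++ a :: v' → u ∈ L → v ∈ K → u' ∈ L → v' ∈ K → u = u') :
    SeriesSet {w | ∃ u v, w = u ++ a :: v ∧ u ∈ L ∧ v ∈ K} := by
  unfold SeriesSet
  convert MonomialSeries.letterConv a hL hK using 1
  funext w
  have split : ∀ i, w[i]? = some a → w = w.take i ++ a :: w.drop (i + 1) := by
    intro i hi
    obtain ⟨hl, e⟩ := List.getElem?_eq_some_iff.1 hi
    rw [← e, ← List.drop_eq_getElem_cons hl, List.take_append_drop]
  have zero : ∀ i, ¬ (w[i]? = some a ∧ w.take i ∈ L ∧ w.drop (i + 1) ∈ K) →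
      (open scoped Classical in if w[i]? = some a then
        charSeries L (w.take i) * charSeries K (w.drop (i + 1)) else 0) = 0 := by
    intro i hi
    split_ifs with e
    · by_cases h1 : w.take i ∈ L
      · rw [charSeries_of_notMem (L := K) fun h2 => hi ⟨e, h1, h2⟩, mul_zero]
      · rw [charSeries_of_notMem h1, zero_mul]
    · rfl
  by_cases hw : ∃ u v, w = u ++ a :: v ∧ u ∈ L ∧ v ∈ K
  · rw [charSeries_of_mem hw]
    obtain ⟨u, v, rfl, hu, hv⟩ := hw
    rw [letterConv, Finset.sum_eq_single u.length]
    · simp [charSeries_of_mem hu, charSeries_of_mem hv]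
    · intro i hi hne
      refine zero i ?_
      rintro ⟨e, h1, h2⟩
      have := h _ _ _ _ (split i e) hu hv h1 h2
      have := congrArg List.length this
      rw [List.length_take] at this
      have := Finset.mem_range.1 hi
      omega
    · simp
  · rw [charSeries_of_notMem hw, letterConv, eq_comm]
    exact Finset.sum_eq_zero fun i _ => zero i fun ⟨e, h1, h2⟩ => hw ⟨_, _, split i e, h1, h2⟩

theorem seriesSet_univ : SeriesSet (Set.univ : Set (List A)) := by
  simpa using seriesSet_setOf_forall_mem (Set.univ : Set A)

theorem seriesSet_avoid (a : A) : SeriesSet {w : List A | a ∉ w} := by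
  convert seriesSet_setOf_forall_mem ({a}ᶜ : Set A) using 1
  ext w
  simp only [Set.mem_ofPred_eq, Set.mem_compl_iff, Set.mem_singleton_iff]
  exact ⟨fun h x hx e => h (e ▸ hx), fun h ha => h a ha rfl⟩

theorem SeriesSet.left (a : A) (hL : SeriesSet L) (hK : SeriesSet K) :
    SeriesSet {w | ∃ u v, w = u ++ a :: v ∧ a ∉ u ∧ u ∈ L ∧ v ∈ K} := by
  convert ((seriesSet_avoid a).inter hL).product a hK ?_ using 1
  · ext w; simp [and_assoc]
  · rintro u v u' v' e ⟨hu, -⟩ - ⟨hu', -⟩ -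
    exact (append_cons_inj_of_notMem_left e hu hu').1

theorem SeriesSet.right (a : A) (hL : SeriesSet L) (hK : SeriesSet K) :
    SeriesSet {w | ∃ u v, w = u ++ a :: v ∧ a ∉ v ∧ u ∈ L ∧ v ∈ K} := by
  convert hL.product a ((seriesSet_avoid a).inter hK) ?_ using 1
  · ext w
    simp only [Set.mem_ofPred_eq, Set.mem_inter_iff]
    grind
  · rintro u v u' v' e - ⟨hu, -⟩ - ⟨hu', -⟩
    exact (append_cons_inj_of_notMem_right e hu hu').1

theorem DetSet.seriesSet (h : DetSet L) : SeriesSet L ∧ SeriesSet Lᶜ := by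
  induction h with
  | univ =>
    refine ⟨seriesSet_univ, ?_⟩
    unfold SeriesSet
    convert MonomialSeries.zero using 1
    funext w
    simp [charSeries]
  | avoid a =>
    refine ⟨seriesSet_avoid a, ?_⟩
    convert seriesSet_univ.left a seriesSet_univ using 1
    ext w
    simp only [Set.mem_compl_iff, Set.mem_ofPred_eq, not_not, Set.mem_univ, and_true]
    exact ⟨exists_first_factor, by rintro ⟨u, v, rfl, -⟩; simp⟩
  | compl _ ih => exact ⟨ih.2, by simpa using ih.1⟩
  | @union L L' _ _ ih ih' =>
    refine ⟨?_, by simpa [Set.compl_union] using ih.2.inter ih'.2⟩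
    have : L ∪ L' = L ∪ (Lᶜ ∩ L') := by ext w; simp; tauto
    rw [this]
    exact ih.1.union_of_disjoint (ih.2.inter ih'.1) fun w hw h => h.1 hw
  | @left a L L' _ _ ih ih' =>
    refine ⟨ih.1.left a ih'.1, ?_⟩
    convert (seriesSet_avoid a).union_of_disjoint (((ih.2.left a seriesSet_univ)).union_of_disjoint
      (ih.1.left a ih'.2) ?_) ?_ using 1
    · ext w
      by_cases ha : a ∈ w
      · obtain ⟨u, v, rfl, hu⟩ := exists_first_factor ha
        have key : ∀ P Q : Set (List A), (∃ u' v', u ++ a :: v = u' ++ a :: v' ∧ a ∉ u' ∧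
            u' ∈ P ∧ v' ∈ Q) ↔ u ∈ P ∧ v ∈ Q := by
          intro P Q
          constructor
          · rintro ⟨u', v', e, hu', h⟩
            obtain ⟨rfl, rfl⟩ := append_cons_inj_of_notMem_left e hu hu'
            exact h
          · intro h; exact ⟨u, v, rfl, hu, h⟩
        refine (not_congr (key L L')).trans (Iff.trans ?_
          (or_congr Iff.rfl (or_congr (key Lᶜ Set.univ) (key L L'ᶜ))).symm)
        simp
        tauto
      · have key : ∀ P Q : Set (List A), ¬ ∃ u' v', w = u' ++ a :: v' ∧ a ∉ u' ∧
            u' ∈ P ∧ v' ∈ Q := by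
          rintro P Q ⟨u', v', rfl, -⟩
          simp at ha
        exact iff_of_true (key L L') (Or.inl ha)
    · rintro w ⟨u, v, rfl, hu, h1, -⟩ ⟨u', v', e, hu', h2, -⟩
      obtain ⟨rfl, rfl⟩ := append_cons_inj_of_notMem_left e hu hu'
      exact h1 h2
    · rintro w hw (⟨u, v, rfl, -⟩ | ⟨u, v, rfl, -⟩) <;> simp at hw
  | @right a L L' _ _ ih ih' =>
    refine ⟨ih.1.right a ih'.1, ?_⟩
    convert (seriesSet_avoid a).union_of_disjoint (((ih.2.right a seriesSet_univ)).union_of_disjoint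
      (ih.1.right a ih'.2) ?_) ?_ using 1
    · ext w
      by_cases ha : a ∈ w
      · obtain ⟨u, v, rfl, hu⟩ := exists_last_factor ha
        have key : ∀ P Q : Set (List A), (∃ u' v', u ++ a :: v = u' ++ a :: v' ∧ a ∉ v' ∧
            u' ∈ P ∧ v' ∈ Q) ↔ u ∈ P ∧ v ∈ Q := by
          intro P Q
          constructor
          · rintro ⟨u', v', e, hu', h⟩
            obtain ⟨rfl, rfl⟩ := append_cons_inj_of_notMem_right e hu hu'
            exact h
          · intro h; exact ⟨u, v, rfl, hu, h⟩
        refine (not_congr (key L L')).trans (Iff.trans ?_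
          (or_congr Iff.rfl (or_congr (key Lᶜ Set.univ) (key L L'ᶜ))).symm)
        simp
        tauto
      · have key : ∀ P Q : Set (List A), ¬ ∃ u' v', w = u' ++ a :: v' ∧ a ∉ v' ∧
            u' ∈ P ∧ v' ∈ Q := by
          rintro P Q ⟨u', v', rfl, -⟩
          simp at ha
        exact iff_of_true (key L L') (Or.inl ha)
    · rintro w ⟨u, v, rfl, hu, h1, -⟩ ⟨u', v', e, hu', h2, -⟩
      obtain ⟨rfl, rfl⟩ := append_cons_inj_of_notMem_right e hu hu'
      exact h1 h2
    · rintro w hw (⟨u, v, rfl, -⟩ | ⟨u, v, rfl, -⟩) <;> simp at hw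

end SeriesSet

section ParseCountClosed

variable {A : Type u}

theorem parseCount_nil_ne_zero {H : Set A} {w : List A} :
    parseCount H [] w ≠ 0 ↔ ∀ x ∈ w, x ∈ H := by
  induction w with
  | nil => simp [parseCount]
  | cons x w ih => by_cases h : x ∈ H <;> simp [parseCount, h, ← ih]

theorem parseCount_cons_ne_zero {H : Set A} {t : List (A × Set A)} {x : A} {w : List A} :
    parseCount H t (x :: w) ≠ 0 ↔ x ∈ H ∧ parseCount H t w ≠ 0 ∨
      ∃ K s, t = (x, K) :: s ∧ parseCount K s w ≠ 0 := by
  cases t with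
  | nil => by_cases h : x ∈ H <;> simp [parseCount, h]
  | cons c t =>
    obtain ⟨c, K⟩ := c
    by_cases hc : x = c
    · subst hc
      by_cases h : x ∈ H <;> simp [parseCount, h]
      tauto
    · by_cases h : x ∈ H <;> simp [parseCount, h, hc, Ne.symm hc]

theorem parseCount_append_ne_zero {H : Set A} {t : List (A × Set A)} {u v : List A} :
    parseCount H t (u ++ v) ≠ 0 ↔ ∃ j ≤ t.length, parseCount H (t.take j) u ≠ 0 ∧
      parseCount (lastSet H (t.take j)) (t.drop j) v ≠ 0 := by
  rw [parseCount_append, Ne, Finset.sum_eq_zero_iff]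
  simp

theorem mul_le_parseCount_append (H : Set A) (t : List (A × Set A)) (u v : List A) {j : ℕ}
    (hj : j ≤ t.length) :
    parseCount H (t.take j) u * parseCount (lastSet H (t.take j)) (t.drop j) v ≤
      parseCount H t (u ++ v) := by
  rw [parseCount_append]
  exact Finset.single_le_sum
    (f := fun j => parseCount H (t.take j) u * parseCount (lastSet H (t.take j)) (t.drop j) v)
    (fun _ _ => Nat.zero_le _) (Finset.mem_range.2 (by omega))

theorem parseCount_map_fst_pos (t : List (A × Set A)) :
    ∀ H : Set A, 0 < parseCount H t (t.map Prod.fst) := by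
  induction t with
  | nil => intro H; simp [parseCount]
  | cons c t ih =>
    intro H
    have := ih c.2
    simp only [List.map_cons, parseCount]
    rw [if_pos trivial]
    omega

theorem mem_of_parseCount_ne_zero {w : List A} : ∀ {H : Set A} {t : List (A × Set A)},
    parseCount H t w ≠ 0 → ∀ c ∈ t, c.1 ∈ w := by
  induction w with
  | nil => intro H t h; cases t <;> simp [parseCount] at h ⊢
  | cons x w ih =>
    intro H t h c hc
    rcases parseCount_cons_ne_zero.1 h with ⟨-, h1⟩ | ⟨K, s, rfl, h1⟩
    · exact List.mem_cons_of_mem _ (ih h1 c hc)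
    · rcases List.mem_cons.1 hc with rfl | hc
      · simp
      · exact List.mem_cons_of_mem _ (ih h1 c hc)

theorem parseCount_le_append_of_subset {H : Set A} {t : List (A × Set A)} {u v : List A}
    (hu : ∀ x ∈ u, x ∈ H) : parseCount H t v ≤ parseCount H t (u ++ v) := by
  have := mul_le_parseCount_append H t u v (Nat.zero_le _)
  have h1 := Nat.pos_of_ne_zero (parseCount_nil_ne_zero.2 hu)
  simp only [List.take_zero, List.drop_zero, lastSet] at this
  nlinarith

theorem exists_mem_notMem_head_or_last {H : Set A} {t : List (A × Set A)} (ht : t ≠ [])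
    (h : ∀ w, parseCount H t w ≤ 1) : ∃ c ∈ t, c.1 ∉ H ∨ c.1 ∉ lastSet H t := by
  by_contra! hc
  obtain ⟨c, t, rfl⟩ := List.exists_cons_of_ne_nil ht
  have h1 := h (c.1 :: (t.map Prod.fst ++ (c :: t).map Prod.fst))
  simp only [parseCount] at h1
  rw [if_pos (hc c (by simp)).1, if_pos trivial] at h1
  have h2 : 0 < parseCount H (c :: t) (t.map Prod.fst ++ (c :: t).map Prod.fst) := by
    refine (parseCount_map_fst_pos (c :: t) H).trans_le (parseCount_le_append_of_subset ?_)
    intro x hx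
    obtain ⟨d, hd, rfl⟩ := List.mem_map.1 hx
    exact (hc d (by simp [hd])).1
  have h3 := mul_le_parseCount_append c.2 t (t.map Prod.fst) ((c :: t).map Prod.fst) le_rfl
  rw [List.take_length, List.drop_length] at h3
  have h4 := parseCount_map_fst_pos t c.2
  have h5 : 0 < parseCount (lastSet c.2 t) [] ((c :: t).map Prod.fst) := by
    refine Nat.pos_of_ne_zero (parseCount_nil_ne_zero.2 ?_)
    intro x hx
    obtain ⟨d, hd, rfl⟩ := List.mem_map.1 hx
    exact (hc d hd).2
  have := Nat.mul_pos h4 h5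
  omega

theorem parseCount_take_le_one {H : Set A} {t : List (A × Set A)}
    (h : ∀ w, parseCount H t w ≤ 1) {j : ℕ} (hj : j ≤ t.length) (w : List A) :
    parseCount H (t.take j) w ≤ 1 := by
  have h1 := mul_le_parseCount_append H t w ((t.drop j).map Prod.fst) hj
  have h2 := parseCount_map_fst_pos (t.drop j) (lastSet H (t.take j))
  exact (Nat.le_mul_of_pos_right _ h2).trans (h1.trans (h _))

theorem parseCount_drop_le_one {H : Set A} {t : List (A × Set A)}
    (h : ∀ w, parseCount H t w ≤ 1) {j : ℕ} (hj : j ≤ t.length) (w : List A) :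
    parseCount (lastSet H (t.take j)) (t.drop j) w ≤ 1 := by
  have h1 := mul_le_parseCount_append H t ((t.take j).map Prod.fst) w hj
  have h2 := parseCount_map_fst_pos (t.take j) H
  exact (Nat.le_mul_of_pos_left _ h2).trans (h1.trans (h _))

theorem parseCount_tail_le_one {H : Set A} {a : A} {K : Set A} {t : List (A × Set A)}
    (h : ∀ w, parseCount H ((a, K) :: t) w ≤ 1) (w : List A) : parseCount K t w ≤ 1 := by
  have := h (a :: w)
  simp only [parseCount] at this
  rw [if_pos trivial] at this
  omega

theorem profileClosed_parseCount : ∀ (n : ℕ) (H : Set A) (t : List (A × Set A)), t.length ≤ n →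
    (∀ w, parseCount H t w ≤ 1) → ProfileClosed (n + 1) {w | parseCount H t w ≠ 0} := by
  have base : ∀ (n : ℕ) (H : Set A), ProfileClosed (n + 1) {w | parseCount H [] w ≠ 0} := by
    intro n H w w' e hw
    rw [Set.mem_ofPred_eq, parseCount_nil_ne_zero] at hw ⊢
    exact fun x hx => hw x (mem_of_profile e.symm hx)
  intro n
  induction n with
  | zero =>
    intro H t ht _
    obtain rfl := List.length_eq_zero_iff.1 (Nat.le_zero.1 ht)
    exact base 0 H
  | succ n ih =>
    intro H t ht hu
    by_cases hne : t = []
    · subst hne; exact base _ H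
    obtain ⟨⟨a, K⟩, hc, ha⟩ := exists_mem_notMem_head_or_last hne hu
    intro w w' e hw
    have haw : a ∈ w := mem_of_parseCount_ne_zero hw _ hc
    have combine : ∀ j ≤ t.length, ∀ u v, parseCount H (t.take j) u ≠ 0 →
        parseCount (lastSet H (t.take j)) (t.drop j) v ≠ 0 → parseCount H t (u ++ v) ≠ 0 :=
      fun j hj u v h1 h2 => parseCount_append_ne_zero.2 ⟨j, hj, h1, h2⟩
    rcases ha with ha | ha
    · obtain ⟨u, v, rfl, hau⟩ := exists_first_factor haw
      obtain ⟨u', v', rfl, -, eu, ev⟩ := profile_first e hau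
      obtain ⟨j, hj, h1, h2⟩ := parseCount_append_ne_zero.1 hw
      have hjn : j ≠ t.length := by
        rintro rfl
        rw [List.take_length] at h1
        exact hau (mem_of_parseCount_ne_zero h1 _ hc)
      have h1' := ih H (t.take j) (by simp; omega) (parseCount_take_le_one hu hj) _ _ eu h1
      have hd := parseCount_drop_le_one hu hj
      refine combine j hj _ _ h1' (parseCount_cons_ne_zero.2 ?_)
      rcases parseCount_cons_ne_zero.1 h2 with ⟨hB, h2⟩ | ⟨K', s, es, h2⟩
      · have hj0 : j ≠ 0 := by rintro rfl; exact ha hB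
        exact Or.inl ⟨hB, ih _ (t.drop j) (by simp; omega) hd _ _ ev h2⟩
      · rw [es] at hd
        have hl := congrArg List.length es
        simp only [List.length_drop, List.length_cons] at hl
        exact Or.inr ⟨K', s, es, ih K' s (by omega) (parseCount_tail_le_one hd) _ _ ev h2⟩
    · obtain ⟨u, v, rfl, hav⟩ := exists_last_factor haw
      obtain ⟨u', v', rfl, -, eu, ev⟩ := profile_last e hav
      obtain ⟨j, hj, h1, h2⟩ := parseCount_append_ne_zero.1 hw
      have hd := parseCount_drop_le_one hu hj
      have hjn : j ≠ t.length := by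
        rintro rfl
        rw [List.take_length, List.drop_length] at h2
        rcases parseCount_cons_ne_zero.1 h2 with ⟨hB, -⟩ | ⟨K', s, es, -⟩
        · exact ha hB
        · simp at es
      have h1' := ih H (t.take j) (by simp; omega) (parseCount_take_le_one hu hj) _ _ eu h1
      refine combine j hj _ _ h1' (parseCount_cons_ne_zero.2 ?_)
      rcases parseCount_cons_ne_zero.1 h2 with ⟨hB, h2⟩ | ⟨K', s, es, h2⟩
      · have hj0 : j ≠ 0 := by
          rintro rfl
          exact hav (mem_of_parseCount_ne_zero h2 _ hc)
        exact Or.inl ⟨hB, ih _ (t.drop j) (by simp; omega) hd _ _ ev h2⟩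
      · rw [es] at hd
        have hl := congrArg List.length es
        simp only [List.length_drop, List.length_cons] at hl
        exact Or.inr ⟨K', s, es, ih K' s (by omega) (parseCount_tail_le_one hd) _ _ ev h2⟩

theorem SeriesSet.exists_profileClosed {L : Set (List A)} (h : SeriesSet L) :
    ∃ n, ProfileClosed n L := by
  obtain ⟨n, m, hm, -, hL⟩ := (mem_unambiguousLanguages_iff (L : Language A)).2 h
  choose N hN using fun i : Fin n => show ∃ k, ProfileClosed k {w | w ∈ (m i).language} from
    ⟨(m i).tail.length + 1, by
      simp only [Monomial.mem_language_iff]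
      exact profileClosed_parseCount _ _ _ le_rfl ((m i).unambiguous_iff.1 (hm i))⟩
  refine ⟨Finset.univ.sup N, fun w w' e hw => ?_⟩
  obtain ⟨i, hi⟩ := (hL w).1 hw
  exact (hL w').2 ⟨i, (hN i).mono (Finset.le_sup (Finset.mem_univ i)) w w' e hi⟩

end ParseCountClosed

theorem mem_unambiguousLanguages_iff_detSet {A : Type u} [Finite A] (L : Language A) :
    L ∈ unambiguousLanguages A ↔ DetSet (L : Set (List A)) := by
  rw [mem_unambiguousLanguages_iff]
  refine ⟨fun h => ?_, fun h => h.seriesSet.1⟩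
  obtain ⟨n, hn⟩ := SeriesSet.exists_profileClosed h
  exact .of_profileClosed hn

section PosPred

variable {A : Type u}

/-- The predicate `U` on positions depends only on the letter at the position and on the
depth-`n` profiles of the two parts of the word around it. -/
def HasLevel (n : ℕ) (U : List A → ℕ → Prop) : Prop :=
  ∀ u u' a v v', profile n u = profile n u' → profile n v = profile n v' →
    U (u ++ a :: v) u.length → U (u' ++ a :: v') u'.length

/-- `U` holds at no two positions of a word. -/
def PosFunctional (U : List A → ℕ → Prop) : Prop :=
  ∀ w i j, i < w.length → j < w.length → U w i → U w j → i = j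

/-- `U` holds on a convex set of positions of each word. -/
def PosConvex (U : List A → ℕ → Prop) : Prop :=
  ∀ w i j k, i < j → j < k → k < w.length → U w i → U w k → U w j

/-- `U` holds on an initial segment of positions of each word. -/
def PosDown (U : List A → ℕ → Prop) : Prop :=
  ∀ w i j, i < j → j < w.length → U w j → U w i

/-- The words in which some position satisfies `U`. -/
def existsPos (U : List A → ℕ → Prop) : Set (List A) := {w | ∃ k < w.length, U w k}

/-- The predicate on factors obtained from `U` by surrounding the factor by `p` and `q`. -/
def posContext (p q : List A) (U : List A → ℕ → Prop) (x : List A) (k : ℕ) : Prop :=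
  U (p ++ x ++ q) (p.length + k)

theorem exists_split_of_lt {w : List A} {k : ℕ} (h : k < w.length) :
    ∃ u a v, w = u ++ a :: v ∧ u.length = k :=
  ⟨w.take k, w[k], w.drop (k + 1), by rw [← List.drop_eq_getElem_cons h, List.take_append_drop],
    by rw [List.length_take]; omega⟩

namespace HasLevel

variable {n m : ℕ} {U V : List A → ℕ → Prop}

theorem mono (hnm : n ≤ m) (h : HasLevel n U) : HasLevel m U :=
  fun u u' a v v' hu hv => h u u' a v v' (profile_mono hnm hu) (profile_mono hnm hv)

theorem congr (h : HasLevel n U) (e : ∀ w k, k < w.length → (U w k ↔ V w k)) : HasLevel n V := by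
  intro u u' a v v' hu hv hV
  rw [← e _ _ (by simp)] at hV ⊢
  exact h u u' a v v' hu hv hV

theorem not (h : HasLevel n U) : HasLevel n fun w k => ¬ U w k :=
  fun u u' a v v' hu hv h1 h2 => h1 (h u' u a v' v hu.symm hv.symm h2)

theorem and (h : HasLevel n U) (h' : HasLevel n V) : HasLevel n fun w k => U w k ∧ V w k :=
  fun u u' a v v' hu hv ⟨h1, h2⟩ => ⟨h u u' a v v' hu hv h1, h' u u' a v v' hu hv h2⟩

theorem or (h : HasLevel n U) (h' : HasLevel n V) : HasLevel n fun w k => U w k ∨ V w k :=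
  fun u u' a v v' hu hv => Or.imp (h u u' a v v' hu hv) (h' u u' a v v' hu hv)

theorem letter (n : ℕ) (a : A) : HasLevel n fun w k => w[k]? = some a := by
  intro u u' b v v' _ _ h
  simpa using h

theorem context (h : HasLevel n U) (p q : List A) : HasLevel n (posContext p q U) := by
  intro u u' a v v' hu hv hU
  have := h (p ++ u) (p ++ u') a (v ++ q) (v' ++ q) (profile_append rfl hu) (profile_append hv rfl)
  simp only [posContext, List.length_append, List.append_assoc, List.cons_append] at hU this ⊢
  exact this hU

/-- The context of a position may be replaced by another one with the same profiles. -/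
theorem change_context (h : HasLevel n U) {p p' q q' x : List A} {k : ℕ} (hk : k < x.length)
    (hp : profile n p = profile n p') (hq : profile n q = profile n q')
    (hU : posContext p q U x k) : posContext p' q' U x k := by
  obtain ⟨u, a, v, rfl, rfl⟩ := exists_split_of_lt hk
  have := h (p ++ u) (p' ++ u) a (v ++ q) (v ++ q') (profile_append hp rfl) (profile_append rfl hq)
  simp only [posContext, List.length_append, List.append_assoc, List.cons_append] at hU this ⊢
  exact this hU

end HasLevel

theorem PosConvex.context {U : List A → ℕ → Prop} (h : PosConvex U) (p q : List A) :
    PosConvex (posContext p q U) := by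
  intro w i j k hij hjk hk
  exact h _ _ _ _ (by omega) (by omega) (by simp; omega)

theorem PosDown.context {U : List A → ℕ → Prop} (h : PosDown U) (p q : List A) :
    PosDown (posContext p q U) := by
  intro w i j hij hj
  exact h _ _ _ (by omega) (by simp; omega)

theorem exists_profileClosed_existsPos_of_functional [Finite A] (n : ℕ) :
    ∃ m, ∀ U : List A → ℕ → Prop, HasLevel n U → PosFunctional U →
      ProfileClosed m (existsPos U) := by
  have key : ∀ p : Profile A n × A × Profile A n, ∃ m,
      (∀ u v u' v', u ++ p.2.1 :: v = u' ++ p.2.1 :: v' → profile n u = p.1 →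
        profile n v = p.2.2 → profile n u' = p.1 → profile n v' = p.2.2 → u = u') →
      ProfileClosed m {w | ∃ u v, w = u ++ p.2.1 :: v ∧ profile n u = p.1 ∧
        profile n v = p.2.2} := by
    rintro ⟨s, a, t⟩
    by_cases h : ∀ u v u' v', u ++ a :: v = u' ++ a :: v' → profile n u = s →
        profile n v = t → profile n u' = s → profile n v' = t → u = u'
    · have hs : ∀ s, SeriesSet {u : List A | profile n u = s} := by
        intro s
        refine (DetSet.of_profileClosed (n := n) ?_).seriesSet.1
        intro w w' e hw
        exact e.symm.trans hw
      obtain ⟨m, hm⟩ := ((hs s).product a (hs t) h).exists_profileClosed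
      exact ⟨m, fun _ => hm⟩
    · exact ⟨0, fun h' => absurd h' h⟩
  choose M hM using key
  have := Fintype.ofFinite (Profile A n × A × Profile A n)
  refine ⟨Finset.univ.sup M, fun U hU hF w w' e => ?_⟩
  rintro ⟨k, hk, hUk⟩
  obtain ⟨u, a, v, rfl, rfl⟩ := exists_split_of_lt hk
  have hS := (hM (profile n u, a, profile n v) ?_).mono
    (Finset.le_sup (f := M) (Finset.mem_univ _)) _ _ e ⟨u, v, rfl, rfl, rfl⟩
  · obtain ⟨u', v', rfl, hu', hv'⟩ := hS
    exact ⟨u'.length, by simp, hU _ _ _ _ _ hu'.symm hv'.symm hUk⟩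
  · intro x y x' y' e' hx hy hx' hy'
    have h1 := hU u x a v y hx.symm hy.symm hUk
    have h2 := hU u x' a v y' hx'.symm hy'.symm hUk
    dsimp only at e'
    rw [← e'] at h2
    exact (List.append_inj e' (hF _ _ _ (by simp) (by rw [e']; simp) h1 h2)).1

theorem exists_profileClosed_existsPos_of_convex [Finite A] (n : ℕ) :
    ∃ m, ∀ U : List A → ℕ → Prop, HasLevel n U → PosConvex U → ∀ a,
      ProfileClosed m (existsPos fun w k => w[k]? = some a ∧ U w k) := by
  obtain ⟨m, hm⟩ := exists_profileClosed_existsPos_of_functional (A := A) (n + 1)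
  refine ⟨m, fun U hU hC a => ?_⟩
  classical
  have e : existsPos (fun w k => w[k]? = some a ∧ U w k) = existsPos fun w k =>
      (w[k]? = some a ∧ U w k) ∧ ∀ j < k, ¬ (w[j]? = some a ∧ U w j) := by
    ext w
    constructor
    · rintro ⟨k, hk, h⟩
      have hex : ∃ k, k < w.length ∧ w[k]? = some a ∧ U w k := ⟨k, hk, h⟩
      refine ⟨Nat.find hex, (Nat.find_spec hex).1, (Nat.find_spec hex).2, fun j hj h' => ?_⟩
      exact Nat.find_min hex hj ⟨hj.trans (Nat.find_spec hex).1, h'⟩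
    · rintro ⟨k, hk, h, -⟩
      exact ⟨k, hk, h⟩
  rw [e]
  refine hm _ ?_ ?_
  · rintro u u' b v v' hu hv ⟨h1, h2⟩
    have h1' := ((HasLevel.letter n a).and hU) u u' b v v' (profile_of_succ hu)
      (profile_of_succ hv) h1
    refine ⟨h1', fun j hj hj' => ?_⟩
    obtain ⟨hja, hjU⟩ := hj'
    have ha : a ∈ u' := by
      rw [List.getElem?_append_left hj] at hja
      exact List.mem_of_getElem? hja
    obtain ⟨x, y, rfl, hy⟩ := exists_last_factor ha
    have hx : U ((x ++ a :: y) ++ b :: v') x.length := by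
      rcases lt_trichotomy j x.length with h | h | h
      · exact hC _ _ _ _ h (by simp) (by simp) hjU h1'.2
      · rwa [h] at hjU
      · exfalso
        rw [List.getElem?_append_left hj, List.getElem?_append_right (by omega)] at hja
        obtain ⟨i, hi⟩ : ∃ i, j - x.length = i + 1 := ⟨j - x.length - 1, by omega⟩
        rw [hi, List.getElem?_cons_succ] at hja
        exact hy (List.mem_of_getElem? hja)
    obtain ⟨x', y', rfl, -, ex, ey⟩ := profile_last hu.symm hy
    refine h2 x'.length (by simp) ⟨by simp, ?_⟩
    have := hU x x' a (y ++ b :: v') (y' ++ b :: v) ex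
      (profile_append ey (profile_cons b (profile_of_succ hv.symm)))
    simp only [List.append_assoc, List.cons_append] at hx this ⊢
    exact this hx
  · rintro w i j - - ⟨h1, h2⟩ ⟨h3, h4⟩
    rcases lt_trichotomy i j with h | h | h
    · exact absurd h1 (h4 i h)
    · exact h
    · exact absurd h3 (h2 j h)

/-- The predicate `U` depends only on the letter at the position and on the downward closed
predicates of level `n` that hold there. -/
def PiecewiseLevel (n : ℕ) (U : List A → ℕ → Prop) : Prop :=
  ∀ w w' k k', k < w.length → k' < w'.length → w[k]? = w'[k']? →
    (∀ D, HasLevel n D → PosDown D → (D w k ↔ D w' k')) → U w k → U w' k'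

namespace PiecewiseLevel

variable {n m : ℕ} {U V : List A → ℕ → Prop}

theorem mono (hnm : n ≤ m) (h : PiecewiseLevel n U) : PiecewiseLevel m U :=
  fun w w' k k' hk hk' e hD => h w w' k k' hk hk' e fun D hn => hD D (hn.mono hnm)

theorem congr (h : PiecewiseLevel n U) (e : ∀ w k, k < w.length → (U w k ↔ V w k)) :
    PiecewiseLevel n V := by
  intro w w' k k' hk hk' el hD
  rw [← e _ _ hk, ← e _ _ hk']
  exact h w w' k k' hk hk' el hD

theorem hasLevel (h : PiecewiseLevel n U) : HasLevel n U := by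
  intro u u' a v v' hu hv
  refine h _ _ _ _ (by simp) (by simp) (by simp) fun D hD _ => ?_
  exact ⟨hD u u' a v v' hu hv, hD u' u a v' v hu.symm hv.symm⟩

theorem not (h : PiecewiseLevel n U) : PiecewiseLevel n fun w k => ¬ U w k :=
  fun w w' k k' hk hk' e hD h1 h2 =>
    h1 (h w' w k' k hk' hk e.symm (fun D hn hd => (hD D hn hd).symm) h2)

theorem or (h : PiecewiseLevel n U) (h' : PiecewiseLevel n V) :
    PiecewiseLevel n fun w k => U w k ∨ V w k :=
  fun w w' k k' hk hk' e hD => Or.imp (h w w' k k' hk hk' e hD) (h' w w' k k' hk hk' e hD)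

theorem letter (n : ℕ) (a : A) : PiecewiseLevel n fun w k => w[k]? = some a :=
  fun _ _ _ _ _ _ e _ h => e.symm.trans h

theorem true (n : ℕ) : PiecewiseLevel (A := A) n fun _ _ => True :=
  fun _ _ _ _ _ _ _ _ _ => trivial

theorem context (h : PiecewiseLevel n U) (p q : List A) :
    PiecewiseLevel n (posContext p q U) := by
  intro w w' k k' hk hk' e hD
  refine h _ _ _ _ (by simp; omega) (by simp; omega) ?_ fun D hn hd =>
    hD _ (hn.context p q) (hd.context p q)
  simpa [List.getElem?_append_left, hk, hk', List.getElem?_append_right] using e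

end PiecewiseLevel

theorem exists_profileClosed_existsPos_of_piecewise [Finite A] (n : ℕ) :
    ∃ m, ∀ U : List A → ℕ → Prop, PiecewiseLevel n U → ProfileClosed m (existsPos U) := by
  obtain ⟨m, hm⟩ := exists_profileClosed_existsPos_of_convex (A := A) n
  refine ⟨m, fun U hU w w' e => ?_⟩
  rintro ⟨k, hk, hUk⟩
  let C : List A → ℕ → Prop := fun x i => ∀ D, HasLevel n D → PosDown D → (D w k ↔ D x i)
  have hC : HasLevel n C := by
    intro u u' a v v' hu hv h D hn hd
    exact (h D hn hd).trans
      ⟨hn u u' a v v' hu hv, hn u' u a v' v hu.symm hv.symm⟩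
  have hC' : PosConvex C := by
    intro x i j l hij hjl hl hi hl' D hn hd
    exact ⟨fun h => hd x j l hjl hl ((hl' D hn hd).1 h),
      fun h => (hi D hn hd).2 (hd x i j hij (hjl.trans hl) h)⟩
  obtain ⟨k', hk', hl, h⟩ := hm C hC hC' w[k] w w' e
    ⟨k, hk, List.getElem?_eq_getElem hk, fun D _ _ => Iff.rfl⟩
  exact ⟨k', hk', hU w w' k k' hk hk' (by rw [hl, List.getElem?_eq_getElem hk]) h hUk⟩

theorem exists_piecewiseLevel_of_convex [Finite A] {n : ℕ} {U : List A → ℕ → Prop}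
    (hU : HasLevel n U) (hC : PosConvex U) : ∃ m, PiecewiseLevel m U := by
  obtain ⟨m, hm⟩ := exists_profileClosed_existsPos_of_convex (A := A) n
  have hm' : ∀ V : List A → ℕ → Prop, HasLevel n V → PosConvex V →
      ProfileClosed m (existsPos V) := by
    rintro V hV hVC w w' e ⟨k, hk, h⟩
    obtain ⟨k', hk', -, h'⟩ := hm V hV hVC w[k] w w' e ⟨k, hk, List.getElem?_eq_getElem hk, h⟩
    exact ⟨k', hk', h'⟩
  have hD : HasLevel (max m n) fun w k => ∃ j, k ≤ j ∧ j < w.length ∧ U w j := by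
    rintro u u' a v v' hu hv ⟨j, hj, hjl, h⟩
    have hu1 := profile_mono (le_max_right m n) hu
    have hv1 := profile_mono (le_max_right m n) hv
    rcases hj.eq_or_lt with rfl | hj
    · exact ⟨u'.length, le_rfl, by simp, hU u u' a v v' hu1 hv1 h⟩
    · have h0 : v ∈ existsPos (posContext (u ++ [a]) [] U) := by
        refine ⟨j - (u.length + 1), by simp at hjl; omega, ?_⟩
        have : u.length + 1 + (j - (u.length + 1)) = j := by omega
        simpa [posContext, this] using h
      obtain ⟨i, hi, h1⟩ := hm' _ (hU.context _ _) (hC.context _ _) v v'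
        (profile_mono (le_max_left m n) hv) h0
      have h2 := hU.change_context hi
        (profile_append hu1 rfl : _ = profile n (u' ++ [a])) rfl h1
      refine ⟨u'.length + 1 + i, by omega, by simp; omega, ?_⟩
      simpa [posContext] using h2
  have hE : HasLevel (max m n) fun w k => ∃ j ≤ k, U w j := by
    rintro u u' a v v' hu hv ⟨j, hj, h⟩
    have hu1 := profile_mono (le_max_right m n) hu
    have hv1 := profile_mono (le_max_right m n) hv
    rcases hj.eq_or_lt with rfl | hj
    · exact ⟨u'.length, le_rfl, hU u u' a v v' hu1 hv1 h⟩
    · have h0 : u ∈ existsPos (posContext [] (a :: v) U) :=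
        ⟨j, hj, by simpa [posContext] using h⟩
      obtain ⟨i, hi, h1⟩ := hm' _ (hU.context _ _) (hC.context _ _) u u'
        (profile_mono (le_max_left m n) hu) h0
      have h2 := hU.change_context hi rfl (profile_cons a hv1) h1
      exact ⟨i, hi.le, by simpa [posContext] using h2⟩
  refine ⟨max m n, fun w w' k k' hk hk' _ h hUk => ?_⟩
  obtain ⟨j, hj, hjl, hj'⟩ := (h _ hD (by
    rintro x i j hij _ ⟨l, hl, h⟩; exact ⟨l, by omega, h⟩)).1 ⟨k, le_rfl, hk, hUk⟩
  have hne := (h _ hE.not (by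
    rintro x i j hij _ h ⟨l, hl, hl'⟩; exact h ⟨l, by omega, hl'⟩)).2.mt
      (not_not.2 ⟨k, le_rfl, hUk⟩)
  obtain ⟨i, hi, hi'⟩ := not_not.1 hne
  rcases hi.eq_or_lt with rfl | hi
  · exact hi'
  rcases hj.eq_or_lt with rfl | hj
  · exact hj'
  · exact hC w' i k' j hi hj hjl hi' hj'

/-- The next position satisfying `P` exists and satisfies `U`. -/
def nextPos (P U : List A → ℕ → Prop) (w : List A) (k : ℕ) : Prop :=
  ∃ j, k < j ∧ j < w.length ∧ P w j ∧ U w j ∧ ∀ i, k < i → i < j → ¬ P w i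

/-- The previous position satisfying `P` exists and satisfies `U`. -/
def prevPos (P U : List A → ℕ → Prop) (w : List A) (k : ℕ) : Prop :=
  ∃ j, j < k ∧ P w j ∧ U w j ∧ ∀ i, j < i → i < k → ¬ P w i

theorem PosConvex.nextPos {U : List A → ℕ → Prop} (P : List A → ℕ → Prop) (hU : PosConvex U) :
    PosConvex (nextPos P U) := by
  rintro w i j k hij hjk hk ⟨i', hi, hil, hPi, hUi, hi'⟩ ⟨k', hk1, hkl, hPk, hUk, hk'⟩
  classical
  have hex : ∃ l, j < l ∧ P w l := ⟨k', by omega, hPk⟩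
  obtain ⟨h1, h2⟩ := Nat.find_spec hex
  have h3 : Nat.find hex ≤ k' := Nat.find_min' hex ⟨by omega, hPk⟩
  have h4 : i' ≤ Nat.find hex := by
    by_contra! h
    exact hi' _ (by omega) h h2
  refine ⟨Nat.find hex, h1, by omega, h2, ?_, fun l hl hl' h => Nat.find_min hex hl' ⟨hl, h⟩⟩
  rcases h4.eq_or_lt with h4 | h4
  · rwa [← h4]
  rcases h3.eq_or_lt with h3 | h3
  · rwa [h3]
  exact hU w _ _ _ h4 h3 hkl hUi hUk

theorem PosConvex.prevPos {U : List A → ℕ → Prop} (P : List A → ℕ → Prop) (hU : PosConvex U) :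
    PosConvex (prevPos P U) := by
  rintro w i j k hij hjk hk ⟨i', hi, hPi, hUi, hi'⟩ ⟨k', hk1, hPk, hUk, hk'⟩
  classical
  let Q : ℕ → Prop := fun l => l < j ∧ P w l
  have hQ : Q i' := ⟨by omega, hPi⟩
  have hib : i' ≤ j := by omega
  have h0 : Q (Nat.findGreatest Q j) := Nat.findGreatest_spec hib hQ
  have h3 : i' ≤ Nat.findGreatest Q j := Nat.le_findGreatest hib hQ
  have h4 : Nat.findGreatest Q j ≤ k' := by
    by_contra! h
    exact hk' _ h (by have := h0.1; omega) h0.2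
  refine ⟨Nat.findGreatest Q j, h0.1, h0.2, ?_, fun l hl hl' h =>
    Nat.findGreatest_is_greatest hl hl'.le ⟨hl', h⟩⟩
  rcases h3.eq_or_lt with h3 | h3
  · rwa [← h3]
  rcases h4.eq_or_lt with h4 | h4
  · rwa [h4]
  exact hU w _ _ _ h3 h4 (by omega) hUi hUk

theorem exists_hasLevel_nextPos [Finite A] {n : ℕ} {P U : List A → ℕ → Prop}
    (hP : PiecewiseLevel n P) (hU : HasLevel n U) : ∃ m, HasLevel m (nextPos P U) := by
  obtain ⟨m₁, hm₁⟩ := exists_profileClosed_existsPos_of_piecewise (A := A) n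
  obtain ⟨m₂, hm₂⟩ := exists_profileClosed_existsPos_of_functional (A := A) (max m₁ n)
  let V : List A → List A → ℕ → Prop := fun p x i =>
    (posContext p [] P x i ∧ posContext p [] U x i) ∧ ∀ j < i, ¬ posContext p [] P x j
  have hV : ∀ p, HasLevel (max m₁ n) (V p) := by
    rintro p u u' a v v' hu hv ⟨h1, h2⟩
    have hu1 := profile_mono (le_max_right m₁ n) hu
    have hv1 := profile_mono (le_max_right m₁ n) hv
    refine ⟨((hP.hasLevel.context p []).and (hU.context p [])) u u' a v v' hu1 hv1 h1, ?_⟩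
    intro j hj hPj
    obtain ⟨i, hi, hPi⟩ := hm₁ _ (hP.context p (a :: v')) u' u
      (profile_mono (le_max_left m₁ n) hu.symm) ⟨j, hj, by simpa [posContext] using hPj⟩
    refine h2 i hi ?_
    simpa [posContext] using hP.hasLevel.change_context hi rfl (profile_cons a hv1.symm) hPi
  have hV' : ∀ p, PosFunctional (V p) := by
    rintro p w i j - - ⟨⟨h1, -⟩, h2⟩ ⟨⟨h3, -⟩, h4⟩
    rcases lt_trichotomy i j with h | h | h
    · exact absurd h1 (h4 i h)
    · exact h
    · exact absurd h3 (h2 j h)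
  have e : ∀ u a v, nextPos P U (u ++ a :: v) u.length ↔ v ∈ existsPos (V (u ++ [a])) := by
    intro u a v
    constructor
    · rintro ⟨j, hj, hjl, h1, h2, h3⟩
      have e1 : u.length + 1 + (j - (u.length + 1)) = j := by omega
      refine ⟨j - (u.length + 1), by simp at hjl; omega,
        ⟨by simpa [posContext, e1] using h1, by simpa [posContext, e1] using h2⟩, fun i hi h => ?_⟩
      exact h3 (u.length + 1 + i) (by omega) (by omega) (by simpa [posContext] using h)
    · rintro ⟨j, hj, ⟨h1, h2⟩, h3⟩
      refine ⟨u.length + 1 + j, by omega, by simp; omega, by simpa [posContext] using h1,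
        by simpa [posContext] using h2, fun i hi hi' h => ?_⟩
      refine h3 (i - (u.length + 1)) (by omega) ?_
      have e1 : u.length + 1 + (i - (u.length + 1)) = i := by omega
      simpa [posContext, e1] using h
  refine ⟨max m₂ n, fun u u' a v v' hu hv h => ?_⟩
  rw [e] at h ⊢
  obtain ⟨i, hi, ⟨h1, h2⟩, h3⟩ :=
    hm₂ _ (hV _) (hV' _) v v' (profile_mono (le_max_left m₂ n) hv) h
  have hp : profile n (u ++ [a]) = profile n (u' ++ [a]) :=
    profile_append (profile_mono (le_max_right m₂ n) hu) rfl
  exact ⟨i, hi, ⟨hP.hasLevel.change_context hi hp rfl h1, hU.change_context hi hp rfl h2⟩,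
    fun j hj h => h3 j hj (hP.hasLevel.change_context (hj.trans hi) hp.symm rfl h)⟩

theorem exists_hasLevel_prevPos [Finite A] {n : ℕ} {P U : List A → ℕ → Prop}
    (hP : PiecewiseLevel n P) (hU : HasLevel n U) : ∃ m, HasLevel m (prevPos P U) := by
  obtain ⟨m₁, hm₁⟩ := exists_profileClosed_existsPos_of_piecewise (A := A) n
  obtain ⟨m₂, hm₂⟩ := exists_profileClosed_existsPos_of_functional (A := A) (max m₁ n)
  let V : List A → List A → ℕ → Prop := fun q x i =>
    (posContext [] q P x i ∧ posContext [] q U x i) ∧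
      ∀ j < x.length, i < j → ¬ posContext [] q P x j
  have hV : ∀ q, HasLevel (max m₁ n) (V q) := by
    rintro q u u' a v v' hu hv ⟨h1, h2⟩
    have hu1 := profile_mono (le_max_right m₁ n) hu
    have hv1 := profile_mono (le_max_right m₁ n) hv
    refine ⟨((hP.hasLevel.context [] q).and (hU.context [] q)) u u' a v v' hu1 hv1 h1, ?_⟩
    intro j hjl hj hPj
    have e1 : u'.length + 1 + (j - (u'.length + 1)) = j := by omega
    obtain ⟨i, hi, hPi⟩ := hm₁ _ (hP.context (u' ++ [a]) q) v' v
      (profile_mono (le_max_left m₁ n) hv.symm)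
      ⟨j - (u'.length + 1), by simp at hjl; omega, by simpa [posContext, e1] using hPj⟩
    refine h2 (u.length + 1 + i) (by simp; omega) (by omega) ?_
    simpa [posContext] using hP.hasLevel.change_context hi
      (profile_append hu1.symm rfl : _ = profile n (u ++ [a])) rfl hPi
  have hV' : ∀ q, PosFunctional (V q) := by
    rintro q w i j hi hj ⟨⟨h1, -⟩, h2⟩ ⟨⟨h3, -⟩, h4⟩
    rcases lt_trichotomy i j with h | h | h
    · exact absurd h3 (h2 j hj h)
    · exact h
    · exact absurd h1 (h4 i hi h)
  have e : ∀ u a v, prevPos P U (u ++ a :: v) u.length ↔ u ∈ existsPos (V (a :: v)) := by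
    intro u a v
    constructor
    · rintro ⟨j, hj, h1, h2, h3⟩
      exact ⟨j, hj, ⟨by simpa [posContext] using h1, by simpa [posContext] using h2⟩,
        fun i hi hji h => h3 i hji hi (by simpa [posContext] using h)⟩
    · rintro ⟨j, hj, ⟨h1, h2⟩, h3⟩
      exact ⟨j, hj, by simpa [posContext] using h1, by simpa [posContext] using h2,
        fun i hi hi' h => h3 i hi' hi (by simpa [posContext] using h)⟩
  refine ⟨max m₂ n, fun u u' a v v' hu hv h => ?_⟩
  rw [e] at h ⊢
  obtain ⟨i, hi, ⟨h1, h2⟩, h3⟩ :=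
    hm₂ _ (hV _) (hV' _) u u' (profile_mono (le_max_left m₂ n) hu) h
  have hq : profile n (a :: v) = profile n (a :: v') :=
    profile_cons a (profile_mono (le_max_right m₂ n) hv)
  exact ⟨i, hi, ⟨hP.hasLevel.change_context hi rfl hq h1, hU.change_context hi rfl hq h2⟩,
    fun j hj hij h => h3 j hj hij (hP.hasLevel.change_context hj rfl hq.symm h)⟩

theorem HasLevel.profileClosed_zero {n : ℕ} {U : List A → ℕ → Prop} (h : HasLevel n U) :
    ProfileClosed (n + 2) {w | 0 < w.length ∧ U w 0} := by
  rintro w w' e ⟨hl, hw⟩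
  cases w with
  | nil => simp at hl
  | cons a v =>
    obtain ⟨u', v', rfl, -, h1, h2⟩ := profile_first (u := []) e (by simp)
    obtain rfl := eq_nil_of_profile h1
    exact ⟨by simp, h [] [] a v v' rfl (profile_of_succ h2) hw⟩

theorem HasLevel.profileClosed_last {n : ℕ} {U : List A → ℕ → Prop} (h : HasLevel n U) :
    ProfileClosed (n + 2) {w | 0 < w.length ∧ U w (w.length - 1)} := by
  rintro w w' e ⟨hl, hw⟩
  rcases List.eq_nil_or_concat w with rfl | ⟨u, a, rfl⟩
  · simp at hl
  · rw [List.concat_eq_append] at e hw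
    obtain ⟨u', v', rfl, -, h1, h2⟩ := profile_last (v := []) e (by simp)
    obtain rfl := eq_nil_of_profile h2
    exact ⟨by simp, by simpa using h u u' a [] [] (profile_of_succ h1) rfl (by simpa using hw)⟩

theorem ProfileClosed.hasLevel {n : ℕ} {L : Set (List A)} (h : ProfileClosed n L) :
    HasLevel n fun w _ => w ∈ L :=
  fun _ _ a _ _ hu hv => h _ _ (profile_append hu (profile_cons a hv))

end PosPred

section Semantics

variable {A : Type u}

/-- `φ` holds at position `k`, given as a natural number. -/
def TLXY.satAt (φ : TLXY A) (w : List A) (k : ℕ) : Prop := ∃ h : k < w.length, φ.Sat w ⟨k, h⟩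

/-- `φ` holds at position `k`, given as a natural number. -/
def RecRanker.satAt (φ : RecRanker A) (w : List A) (k : ℕ) : Prop :=
  ∃ h : k < w.length, φ.Sat w ⟨k, h⟩

/-- `ψ` holds at position `k`, given as a natural number. -/
def TLPlus.satAt (ψ : TLPlus A) (w : List A) (k : ℕ) : Prop :=
  ∃ h : k < w.length, ψ.Sat w ⟨k, h⟩

theorem getElem?_eq_some_iff_get {w : List A} (j : Fin w.length) (a : A) :
    w[j.val]? = some a ↔ w.get j = a := by
  simp

namespace TLXY

variable {a : A} {φ φ' : TLXY A} {w : List A} {k : ℕ}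

theorem satAt_iff (h : k < w.length) : φ.satAt w k ↔ φ.Sat w ⟨k, h⟩ :=
  ⟨fun ⟨_, s⟩ => s, fun s => ⟨h, s⟩⟩

theorem satAt_atom (h : k < w.length) : (atom a).satAt w k ↔ w[k]? = some a := by
  rw [satAt_iff h, Sat, getElem?_eq_some_iff_get ⟨k, h⟩]

theorem satAt_top (h : k < w.length) : (top : TLXY A).satAt w k ↔ True := by
  rw [satAt_iff h, Sat]

theorem satAt_or (h : k < w.length) :
    (or φ φ').satAt w k ↔ φ.satAt w k ∨ φ'.satAt w k := by
  rw [satAt_iff h, satAt_iff h, satAt_iff h, Sat]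

theorem satAt_neg (h : k < w.length) : (neg φ).satAt w k ↔ ¬ φ.satAt w k := by
  rw [satAt_iff h, satAt_iff h, Sat]

theorem satAt_X (h : k < w.length) :
    (X a φ).satAt w k ↔ nextPos (fun w k => w[k]? = some a) φ.satAt w k := by
  rw [satAt_iff h, Sat]
  constructor
  · rintro ⟨j, hj, e, hi, s⟩
    exact ⟨j, hj, j.2, (getElem?_eq_some_iff_get j a).2 e, ⟨j.2, s⟩, fun i h1 h2 e' =>
      hi ⟨i, h2.trans j.2⟩ h1 h2 ((getElem?_eq_some_iff_get ⟨i, h2.trans j.2⟩ a).1 e')⟩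
  · rintro ⟨j, hj, hl, e, ⟨_, s⟩, hi⟩
    exact ⟨⟨j, hl⟩, hj, (getElem?_eq_some_iff_get ⟨j, hl⟩ a).1 e, fun i h1 h2 e' =>
      hi i h1 h2 ((getElem?_eq_some_iff_get i a).2 e'), s⟩

theorem satAt_Y (h : k < w.length) :
    (Y a φ).satAt w k ↔ prevPos (fun w k => w[k]? = some a) φ.satAt w k := by
  rw [satAt_iff h, Sat]
  constructor
  · rintro ⟨j, hj, e, hi, s⟩
    exact ⟨j, hj, (getElem?_eq_some_iff_get j a).2 e, ⟨j.2, s⟩, fun i h1 h2 e' =>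
      hi ⟨i, h2.trans h⟩ h1 h2 ((getElem?_eq_some_iff_get ⟨i, h2.trans h⟩ a).1 e')⟩
  · rintro ⟨j, hj, e, ⟨hl, s⟩, hi⟩
    exact ⟨⟨j, hl⟩, hj, (getElem?_eq_some_iff_get ⟨j, hl⟩ a).1 e, fun i h1 h2 e' =>
      hi i h1 h2 ((getElem?_eq_some_iff_get i a).2 e'), s⟩

theorem satAt_weakX (h : k < w.length) :
    (weakX a φ).satAt w k ↔ ∃ j, k ≤ j ∧ j < w.length ∧ w[j]? = some a ∧ φ.satAt w j ∧
      ∀ i, k ≤ i → i < j → ¬ w[i]? = some a := by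
  rw [satAt_iff h, Sat]
  constructor
  · rintro ⟨j, hj, e, hi, s⟩
    exact ⟨j, hj, j.2, (getElem?_eq_some_iff_get j a).2 e, ⟨j.2, s⟩, fun i h1 h2 e' =>
      hi ⟨i, h2.trans j.2⟩ h1 h2 ((getElem?_eq_some_iff_get ⟨i, h2.trans j.2⟩ a).1 e')⟩
  · rintro ⟨j, hj, hl, e, ⟨_, s⟩, hi⟩
    exact ⟨⟨j, hl⟩, hj, (getElem?_eq_some_iff_get ⟨j, hl⟩ a).1 e, fun i h1 h2 e' =>
      hi i h1 h2 ((getElem?_eq_some_iff_get i a).2 e'), s⟩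

theorem satAt_weakY (h : k < w.length) :
    (weakY a φ).satAt w k ↔ ∃ j, j ≤ k ∧ w[j]? = some a ∧ φ.satAt w j ∧
      ∀ i, j < i → i ≤ k → ¬ w[i]? = some a := by
  rw [satAt_iff h, Sat]
  constructor
  · rintro ⟨j, hj, e, hi, s⟩
    exact ⟨j, hj, (getElem?_eq_some_iff_get j a).2 e, ⟨j.2, s⟩, fun i h1 h2 e' =>
      hi ⟨i, h2.trans_lt h⟩ h1 h2 ((getElem?_eq_some_iff_get ⟨i, h2.trans_lt h⟩ a).1 e')⟩
  · rintro ⟨j, hj, e, ⟨hl, s⟩, hi⟩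
    exact ⟨⟨j, hl⟩, hj, (getElem?_eq_some_iff_get ⟨j, hl⟩ a).1 e, fun i h1 h2 e' =>
      hi i h1 h2 ((getElem?_eq_some_iff_get i a).2 e'), s⟩

theorem satAt_SP (h : k < w.length) : (SP φ).satAt w k ↔ φ.satAt w 0 := by
  rw [satAt_iff h, Sat]
  constructor
  · rintro ⟨⟨_, h⟩, rfl, s⟩; exact ⟨h, s⟩
  · rintro ⟨h, s⟩; exact ⟨⟨0, h⟩, rfl, s⟩

theorem satAt_EP (h : k < w.length) : (EP φ).satAt w k ↔ φ.satAt w (w.length - 1) := by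
  rw [satAt_iff h, Sat]
  constructor
  · rintro ⟨⟨j, h⟩, e, s⟩
    obtain rfl : j = w.length - 1 := by dsimp only at e; omega
    exact ⟨h, s⟩
  · rintro ⟨h, s⟩; exact ⟨⟨_, h⟩, by dsimp only; omega, s⟩

theorem satAt_next (h : k < w.length) :
    (next φ).satAt w k ↔ nextPos (fun _ _ => True) φ.satAt w k := by
  rw [satAt_iff h, Sat]
  constructor
  · rintro ⟨⟨j, hj⟩, e, s⟩
    dsimp only at e
    exact ⟨j, by omega, hj, trivial, ⟨hj, s⟩, fun i h1 h2 => by omega⟩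
  · rintro ⟨j, hj, hl, -, ⟨_, s⟩, hi⟩
    refine ⟨⟨j, hl⟩, ?_, s⟩
    by_contra hne
    exact hi (k + 1) (by omega) (by dsimp only at hne; omega) trivial

theorem satAt_prev (h : k < w.length) :
    (prev φ).satAt w k ↔ prevPos (fun _ _ => True) φ.satAt w k := by
  rw [satAt_iff h, Sat]
  constructor
  · rintro ⟨⟨j, hj⟩, e, s⟩
    dsimp only at e
    exact ⟨j, by omega, trivial, ⟨hj, s⟩, fun i h1 h2 => by omega⟩
  · rintro ⟨j, hj, -, ⟨hl, s⟩, hi⟩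
    refine ⟨⟨j, hl⟩, ?_, s⟩
    by_contra hne
    exact hi (k - 1) (by dsimp only at hne; omega) (by omega) trivial

theorem mem_language_iff : w ∈ φ.language ↔ 0 < w.length ∧ φ.satAt w 0 := by
  constructor
  · rintro ⟨⟨_, h⟩, rfl, s⟩; exact ⟨h, h, s⟩
  · rintro ⟨-, h, s⟩; exact ⟨⟨0, h⟩, rfl, s⟩

theorem exists_hasLevel [Finite A] (φ : TLXY A) : ∃ n, HasLevel n φ.satAt := by
  have hor : ∀ {U V : List A → ℕ → Prop}, (∃ n, HasLevel n U) → (∃ n, HasLevel n V) →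
      ∃ n, HasLevel n fun w k => U w k ∨ V w k := by
    rintro U V ⟨n, hU⟩ ⟨m, hV⟩
    exact ⟨max n m, (hU.mono (le_max_left _ _)).or (hV.mono (le_max_right _ _))⟩
  have hcongr : ∀ {U V : List A → ℕ → Prop}, (∃ n, HasLevel n U) →
      (∀ w k, k < w.length → (V w k ↔ U w k)) → ∃ n, HasLevel n V := by
    rintro U V ⟨n, hU⟩ e
    exact ⟨n, hU.congr fun w k hk => (e w k hk).symm⟩
  induction φ with
  | atom a => exact hcongr ⟨0, .letter 0 a⟩ fun _ _ => satAt_atom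
  | top => exact hcongr ⟨0, (PiecewiseLevel.true 0).hasLevel⟩ fun _ _ => satAt_top
  | or φ φ' ih ih' => exact hcongr (hor ih ih') fun _ _ => satAt_or
  | neg φ ih =>
    obtain ⟨n, hn⟩ := ih
    exact hcongr ⟨n, hn.not⟩ fun _ _ => satAt_neg
  | X a φ ih =>
    obtain ⟨n, hn⟩ := ih
    exact hcongr (exists_hasLevel_nextPos (.letter n a) hn) fun _ _ => satAt_X
  | Y a φ ih =>
    obtain ⟨n, hn⟩ := ih
    exact hcongr (exists_hasLevel_prevPos (.letter n a) hn) fun _ _ => satAt_Y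
  | SP φ ih =>
    obtain ⟨n, hn⟩ := ih
    refine hcongr ⟨_, hn.profileClosed_zero.hasLevel⟩ fun w k hk => (satAt_SP hk).trans ?_
    simp only [Set.mem_ofPred_eq]
    exact ⟨fun h => ⟨by omega, h⟩, fun h => h.2⟩
  | EP φ ih =>
    obtain ⟨n, hn⟩ := ih
    refine hcongr ⟨_, hn.profileClosed_last.hasLevel⟩ fun w k hk => (satAt_EP hk).trans ?_
    simp only [Set.mem_ofPred_eq]
    exact ⟨fun h => ⟨by omega, h⟩, fun h => h.2⟩
  | weakX a φ ih =>
    obtain ⟨n, hn⟩ := ih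
    refine hcongr (hor (V := fun w k => ¬ w[k]? = some a ∧
      nextPos (fun w k => w[k]? = some a) φ.satAt w k) ⟨n, (HasLevel.letter n a).and hn⟩ ?_)
      fun w k hk => (satAt_weakX hk).trans ?_
    · obtain ⟨m, hm⟩ := exists_hasLevel_nextPos (.letter n a) hn
      exact ⟨m, (HasLevel.letter m a).not.and hm⟩
    · constructor
      · rintro ⟨j, hj, hl, e, s, hi⟩
        rcases hj.eq_or_lt with rfl | hj
        · exact Or.inl ⟨e, s⟩
        · exact Or.inr ⟨hi k le_rfl hj, j, hj, hl, e, s, fun i h1 h2 => hi i h1.le h2⟩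
      · rintro (⟨e, s⟩ | ⟨hne, j, hj, hl, e, s, hi⟩)
        · exact ⟨k, le_rfl, hk, e, s, fun i h1 h2 => by omega⟩
        · refine ⟨j, hj.le, hl, e, s, fun i h1 h2 => ?_⟩
          rcases h1.eq_or_lt with rfl | h1
          · exact hne
          · exact hi i h1 h2
  | weakY a φ ih =>
    obtain ⟨n, hn⟩ := ih
    refine hcongr (hor (V := fun w k => ¬ w[k]? = some a ∧
      prevPos (fun w k => w[k]? = some a) φ.satAt w k) ⟨n, (HasLevel.letter n a).and hn⟩ ?_)
      fun w k hk => (satAt_weakY hk).trans ?_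
    · obtain ⟨m, hm⟩ := exists_hasLevel_prevPos (.letter n a) hn
      exact ⟨m, (HasLevel.letter m a).not.and hm⟩
    · constructor
      · rintro ⟨j, hj, e, s, hi⟩
        rcases hj.eq_or_lt with rfl | hj
        · exact Or.inl ⟨e, s⟩
        · exact Or.inr ⟨hi k hj le_rfl, j, hj, e, s, fun i h1 h2 => hi i h1 h2.le⟩
      · rintro (⟨e, s⟩ | ⟨hne, j, hj, e, s, hi⟩)
        · exact ⟨k, le_rfl, e, s, fun i h1 h2 => by omega⟩
        · refine ⟨j, hj.le, e, s, fun i h1 h2 => ?_⟩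
          rcases h2.eq_or_lt with rfl | h2
          · exact hne
          · exact hi i h1 h2
  | next φ ih =>
    obtain ⟨n, hn⟩ := ih
    exact hcongr (exists_hasLevel_nextPos (.true n) hn) fun _ _ => satAt_next
  | prev φ ih =>
    obtain ⟨n, hn⟩ := ih
    exact hcongr (exists_hasLevel_prevPos (.true n) hn) fun _ _ => satAt_prev

end TLXY

namespace RecRanker

variable {φ : RecRanker A} {ψ : TLPlus A} {w : List A} {k : ℕ}

theorem satAt_iff (h : k < w.length) : φ.satAt w k ↔ φ.Sat w ⟨k, h⟩ :=
  ⟨fun ⟨_, s⟩ => s, fun s => ⟨h, s⟩⟩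

theorem satAt_top (h : k < w.length) : (top : RecRanker A).satAt w k ↔ True := by
  rw [satAt_iff h, Sat]

theorem satAt_SP (h : k < w.length) : (SP φ).satAt w k ↔ φ.satAt w 0 := by
  rw [satAt_iff h, Sat]
  constructor
  · rintro ⟨⟨_, h⟩, rfl, s⟩; exact ⟨h, s⟩
  · rintro ⟨h, s⟩; exact ⟨⟨0, h⟩, rfl, s⟩

theorem satAt_EP (h : k < w.length) : (EP φ).satAt w k ↔ φ.satAt w (w.length - 1) := by
  rw [satAt_iff h, Sat]
  constructor
  · rintro ⟨⟨j, h⟩, e, s⟩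
    obtain rfl : j = w.length - 1 := by dsimp only at e; omega
    exact ⟨h, s⟩
  · rintro ⟨h, s⟩; exact ⟨⟨_, h⟩, by dsimp only; omega, s⟩

theorem satAt_X (h : k < w.length) : (X ψ φ).satAt w k ↔ nextPos ψ.satAt φ.satAt w k := by
  rw [satAt_iff h, Sat]
  constructor
  · rintro ⟨j, hj, ⟨e, s⟩, hi⟩
    exact ⟨j, hj, j.2, ⟨j.2, e⟩, ⟨j.2, s⟩, fun i h1 h2 ⟨h3, e'⟩ => hi ⟨i, h3⟩ h1 h2 e'⟩
  · rintro ⟨j, hj, hl, ⟨_, e⟩, ⟨_, s⟩, hi⟩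
    exact ⟨⟨j, hl⟩, hj, ⟨e, s⟩, fun i h1 h2 e' => hi i h1 h2 ⟨i.2, e'⟩⟩

theorem satAt_Y (h : k < w.length) : (Y ψ φ).satAt w k ↔ prevPos ψ.satAt φ.satAt w k := by
  rw [satAt_iff h, Sat]
  constructor
  · rintro ⟨j, hj, ⟨e, s⟩, hi⟩
    exact ⟨j, hj, ⟨j.2, e⟩, ⟨j.2, s⟩, fun i h1 h2 ⟨h3, e'⟩ => hi ⟨i, h3⟩ h1 h2 e'⟩
  · rintro ⟨j, hj, ⟨hl, e⟩, ⟨_, s⟩, hi⟩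
    exact ⟨⟨j, hl⟩, hj, ⟨e, s⟩, fun i h1 h2 e' => hi i h1 h2 ⟨i.2, e'⟩⟩

theorem satAt_X_top (h : k < w.length) :
    (X ψ top).satAt w k ↔ ∃ j, k < j ∧ j < w.length ∧ ψ.satAt w j := by
  rw [satAt_X h]
  constructor
  · rintro ⟨j, hj, hl, s, -⟩; exact ⟨j, hj, hl, s⟩
  · classical
    intro hex
    obtain ⟨h1, h2, h3⟩ := Nat.find_spec hex
    exact ⟨_, h1, h2, h3, (satAt_top h2).2 trivial, fun i h4 h5 h6 =>
      Nat.find_min hex h5 ⟨h4, h5.trans h2, h6⟩⟩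

theorem satAt_Y_top (h : k < w.length) :
    (Y ψ top).satAt w k ↔ ∃ j < k, ψ.satAt w j := by
  rw [satAt_Y h]
  constructor
  · rintro ⟨j, hj, s, -⟩; exact ⟨j, hj, s⟩
  · classical
    rintro ⟨j, hj, s⟩
    let Q : ℕ → Prop := fun l => l < k ∧ ψ.satAt w l
    have h0 : Q (Nat.findGreatest Q k) := Nat.findGreatest_spec hj.le (show Q j from ⟨hj, s⟩)
    exact ⟨_, h0.1, h0.2, (satAt_top (h0.1.trans h)).2 trivial, fun i h1 h2 h3 =>
      Nat.findGreatest_is_greatest h1 h2.le ⟨h2, h3⟩⟩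

end RecRanker

namespace TLPlus

variable {a : A} {ψ ψ' : TLPlus A} {φ : RecRanker A} {w : List A} {k : ℕ}

theorem satAt_iff (h : k < w.length) : ψ.satAt w k ↔ ψ.Sat w ⟨k, h⟩ :=
  ⟨fun ⟨_, s⟩ => s, fun s => ⟨h, s⟩⟩

theorem satAt_atom (h : k < w.length) : (atom a).satAt w k ↔ w[k]? = some a := by
  rw [satAt_iff h, Sat, getElem?_eq_some_iff_get ⟨k, h⟩]

theorem satAt_ranker : (ranker φ).satAt w k ↔ φ.satAt w k := by
  simp only [satAt, RecRanker.satAt, Sat]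

theorem satAt_or (h : k < w.length) :
    (or ψ ψ').satAt w k ↔ ψ.satAt w k ∨ ψ'.satAt w k := by
  rw [satAt_iff h, satAt_iff h, satAt_iff h, Sat]

theorem satAt_neg (h : k < w.length) : (neg ψ).satAt w k ↔ ¬ ψ.satAt w k := by
  rw [satAt_iff h, satAt_iff h, Sat]

theorem mem_language_iff : w ∈ ψ.language ↔ 0 < w.length ∧ ψ.satAt w 0 := by
  constructor
  · rintro ⟨⟨_, h⟩, rfl, s⟩; exact ⟨h, h, s⟩
  · rintro ⟨-, h, s⟩; exact ⟨⟨0, h⟩, rfl, s⟩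

end TLPlus

theorem PosConvex.congr {U V : List A → ℕ → Prop} (h : PosConvex U)
    (e : ∀ w k, k < w.length → (V w k ↔ U w k)) : PosConvex V := by
  intro w i j k hij hjk hk
  rw [e w i (by omega), e w j (by omega), e w k hk]
  exact h w i j k hij hjk hk

mutual

theorem RecRanker.exists_hasLevel_and_posConvex [Finite A] :
    ∀ φ : RecRanker A, (∃ n, HasLevel n φ.satAt) ∧ PosConvex φ.satAt
  | .top => ⟨⟨0, (PiecewiseLevel.true 0).hasLevel.congr fun _ _ hk => (RecRanker.satAt_top hk).symm⟩,
      fun _ _ _ _ _ hjk hk _ _ => (RecRanker.satAt_top (hjk.trans hk)).2 trivial⟩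
  | .SP φ => by
    obtain ⟨⟨n, hn⟩, -⟩ := RecRanker.exists_hasLevel_and_posConvex φ
    refine ⟨⟨_, hn.profileClosed_zero.hasLevel.congr fun w k hk =>
      Iff.trans ?_ (RecRanker.satAt_SP hk).symm⟩, fun w i j k hij hjk hk h _ => ?_⟩
    · simp only [Set.mem_ofPred_eq]
      exact ⟨fun h => h.2, fun h => ⟨by omega, h⟩⟩
    · rw [RecRanker.satAt_SP (by omega)] at h ⊢
      exact h
  | .EP φ => by
    obtain ⟨⟨n, hn⟩, -⟩ := RecRanker.exists_hasLevel_and_posConvex φ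
    refine ⟨⟨_, hn.profileClosed_last.hasLevel.congr fun w k hk =>
      Iff.trans ?_ (RecRanker.satAt_EP hk).symm⟩, fun w i j k hij hjk hk h _ => ?_⟩
    · simp only [Set.mem_ofPred_eq]
      exact ⟨fun h => h.2, fun h => ⟨by omega, h⟩⟩
    · rw [RecRanker.satAt_EP (by omega)] at h ⊢
      exact h
  | .X ψ φ => by
    obtain ⟨⟨n, hn⟩, hc⟩ := RecRanker.exists_hasLevel_and_posConvex φ
    obtain ⟨m, hm⟩ := TLPlus.exists_piecewiseLevel ψ
    obtain ⟨l, hl⟩ := exists_hasLevel_nextPos (hm.mono (le_max_right n m))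
      (hn.mono (le_max_left n m))
    exact ⟨⟨l, hl.congr fun _ _ hk => (RecRanker.satAt_X hk).symm⟩,
      (hc.nextPos _).congr fun _ _ hk => RecRanker.satAt_X hk⟩
  | .Y ψ φ => by
    obtain ⟨⟨n, hn⟩, hc⟩ := RecRanker.exists_hasLevel_and_posConvex φ
    obtain ⟨m, hm⟩ := TLPlus.exists_piecewiseLevel ψ
    obtain ⟨l, hl⟩ := exists_hasLevel_prevPos (hm.mono (le_max_right n m))
      (hn.mono (le_max_left n m))
    exact ⟨⟨l, hl.congr fun _ _ hk => (RecRanker.satAt_Y hk).symm⟩,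
      (hc.prevPos _).congr fun _ _ hk => RecRanker.satAt_Y hk⟩

theorem TLPlus.exists_piecewiseLevel [Finite A] :
    ∀ ψ : TLPlus A, ∃ n, PiecewiseLevel n ψ.satAt
  | .atom a => ⟨0, (PiecewiseLevel.letter 0 a).congr fun _ _ hk => (TLPlus.satAt_atom hk).symm⟩
  | .ranker φ => by
    obtain ⟨⟨n, hn⟩, hc⟩ := RecRanker.exists_hasLevel_and_posConvex φ
    obtain ⟨m, hm⟩ := exists_piecewiseLevel_of_convex hn hc
    exact ⟨m, hm.congr fun _ _ _ => TLPlus.satAt_ranker.symm⟩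
  | .or ψ ψ' => by
    obtain ⟨n, hn⟩ := TLPlus.exists_piecewiseLevel ψ
    obtain ⟨m, hm⟩ := TLPlus.exists_piecewiseLevel ψ'
    exact ⟨max n m, ((hn.mono (le_max_left n m)).or (hm.mono (le_max_right n m))).congr
      fun _ _ hk => (TLPlus.satAt_or hk).symm⟩
  | .neg ψ => by
    obtain ⟨n, hn⟩ := TLPlus.exists_piecewiseLevel ψ
    exact ⟨n, hn.not.congr fun _ _ hk => (TLPlus.satAt_neg hk).symm⟩

end

end Semantics

section Anchor

variable {A : Type u} {a : A} {x u v z : List A}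

theorem getElem?_anchor : (x ++ (u ++ a :: v) ++ z)[x.length + u.length]? = some a := by
  simp

theorem getElem?_factor {y : List A} {i : ℕ} (h1 : x.length ≤ i) (h2 : i < x.length + y.length) :
    (x ++ y ++ z)[i]? = y[i - x.length]? := by
  rw [List.append_assoc, List.getElem?_append_right h1, List.getElem?_append_left (by omega)]

theorem exists_getElem?_factor_iff {y : List A} :
    (∃ i, x.length ≤ i ∧ i < x.length + y.length ∧ (x ++ y ++ z)[i]? = some a) ↔ a ∈ y := by
  constructor
  · rintro ⟨i, h1, h2, h⟩
    rw [getElem?_factor h1 h2] at h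
    exact List.mem_of_getElem? h
  · intro h
    obtain ⟨i, hi⟩ := List.getElem?_of_mem h
    have hl := (List.getElem?_eq_some_iff.1 hi).1
    refine ⟨x.length + i, by omega, by omega, ?_⟩
    rw [getElem?_factor (by omega) (by omega)]
    simpa using hi

theorem getElem?_before_anchor (hu : a ∉ u) {i : ℕ} (h1 : x.length ≤ i)
    (h2 : i < x.length + u.length) : (x ++ (u ++ a :: v) ++ z)[i]? ≠ some a := by
  intro h
  refine hu (exists_getElem?_factor_iff (x := x) (z := a :: v ++ z).1 ⟨i, h1, h2, ?_⟩)
  simpa using h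

theorem getElem?_after_anchor (hv : a ∉ v) {i : ℕ} (h1 : x.length + u.length < i)
    (h2 : i < x.length + (u ++ a :: v).length) : (x ++ (u ++ a :: v) ++ z)[i]? ≠ some a := by
  intro h
  refine hv (exists_getElem?_factor_iff (x := x ++ u ++ [a]) (z := z).1 ⟨i, ?_, ?_, ?_⟩)
  · simp; omega
  · simp at h2 ⊢; omega
  · simpa using h

end Anchor

section TLPlusDefinability

variable {A : Type u}

namespace TLPlus

/-- `ψ` holds exactly at the positions of the factor `y` of `x ++ y ++ z`. -/
def MarksFactor (ψ : TLPlus A) (x y z : List A) : Prop :=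
  ∀ k < (x ++ y ++ z).length,
    (ψ.satAt (x ++ y ++ z) k ↔ x.length ≤ k ∧ k < x.length + y.length)

/-- Conjunction. -/
def and (ψ ψ' : TLPlus A) : TLPlus A := neg (or (neg ψ) (neg ψ'))

theorem satAt_and {ψ ψ' : TLPlus A} {w : List A} {k : ℕ} (h : k < w.length) :
    (and ψ ψ').satAt w k ↔ ψ.satAt w k ∧ ψ'.satAt w k := by
  rw [and, satAt_neg h, satAt_or h, satAt_neg h, satAt_neg h]
  tauto

theorem exists_satAt_iff_mem {L : Set (List A)} (hL : DetSet L) : ∀ I : TLPlus A,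
    ∃ χ : TLPlus A, ∀ x y z, 0 < (x ++ y ++ z).length → I.MarksFactor x y z →
      (χ.satAt (x ++ y ++ z) 0 ↔ y ∈ L) := by
  let aft : A → TLPlus A → TLPlus A := fun a I => ranker (.X (and (atom a) I) .top)
  let bef : A → TLPlus A → TLPlus A := fun a I => ranker (.Y (and (atom a) I) .top)
  let occ : A → TLPlus A → TLPlus A := fun a I => or (and (atom a) I) (aft a I)
  have satAt_aft : ∀ {a I x y z k}, MarksFactor I x y z → k < (x ++ y ++ z).length →
      ((aft a I).satAt (x ++ y ++ z) k ↔ ∃ j, k < j ∧ (x.length ≤ j ∧ j < x.length + y.length) ∧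
        (x ++ y ++ z)[j]? = some a) := by
    intro a I x y z k hI hk
    rw [satAt_ranker, RecRanker.satAt_X_top hk]
    refine exists_congr fun j => and_congr_right fun hj => ?_
    constructor
    · rintro ⟨hl, h⟩
      rw [satAt_and hl, satAt_atom hl, hI j hl] at h
      exact h.symm
    · rintro ⟨h1, h2⟩
      have hl := (List.getElem?_eq_some_iff.1 h2).1
      rw [satAt_and hl, satAt_atom hl, hI j hl]
      exact ⟨hl, h2, h1⟩
  have satAt_bef : ∀ {a I x y z k}, MarksFactor I x y z → k < (x ++ y ++ z).length →
      ((bef a I).satAt (x ++ y ++ z) k ↔ ∃ j, j < k ∧ (x.length ≤ j ∧ j < x.length + y.length) ∧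
        (x ++ y ++ z)[j]? = some a) := by
    intro a I x y z k hI hk
    rw [satAt_ranker, RecRanker.satAt_Y_top hk]
    refine exists_congr fun j => and_congr_right fun hj => ?_
    have hl := hj.trans hk
    rw [satAt_and hl, satAt_atom hl, hI j hl, and_comm]
  have satAt_occ : ∀ {a I x y z}, MarksFactor I x y z → 0 < (x ++ y ++ z).length →
      ((occ a I).satAt (x ++ y ++ z) 0 ↔ a ∈ y) := by
    intro a I x y z hI hk
    rw [satAt_or hk, satAt_and hk, satAt_atom hk, hI 0 hk, satAt_aft hI hk,
      ← exists_getElem?_factor_iff (x := x) (z := z)]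
    constructor
    · rintro (⟨h1, h2⟩ | ⟨j, -, h1, h2⟩)
      · exact ⟨0, h2.1, h2.2, h1⟩
      · exact ⟨j, h1.1, h1.2, h2⟩
    · rintro ⟨j, h1, h2, h3⟩
      rcases Nat.eq_zero_or_pos j with rfl | hj
      · exact Or.inl ⟨h3, h1, h2⟩
      · exact Or.inr ⟨j, hj, ⟨h1, h2⟩, h3⟩
  induction hL with
  | univ =>
    exact fun I => ⟨ranker .top, fun x y z hk _ => by
      rw [satAt_ranker, RecRanker.satAt_top hk]; simp⟩
  | avoid a =>
    exact fun I => ⟨neg (occ a I), fun x y z hk hI => by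
      rw [satAt_neg hk, satAt_occ hI hk]; rfl⟩
  | compl _ ih =>
    intro I
    obtain ⟨χ, hχ⟩ := ih I
    exact ⟨neg χ, fun x y z hk hI => by rw [satAt_neg hk, hχ x y z hk hI]; rfl⟩
  | union _ _ ih ih' =>
    intro I
    obtain ⟨χ, hχ⟩ := ih I
    obtain ⟨χ', hχ'⟩ := ih' I
    exact ⟨or χ χ', fun x y z hk hI => by
      rw [satAt_or hk, hχ x y z hk hI, hχ' x y z hk hI]; rfl⟩
  | @left a L L' _ _ ih ih' =>
    intro I
    obtain ⟨χ, hχ⟩ := ih (and I (and (neg (atom a)) (neg (bef a I))))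
    obtain ⟨χ', hχ'⟩ := ih' (and I (bef a I))
    refine ⟨and (occ a I) (and χ χ'), fun x y z hk hI => ?_⟩
    rw [satAt_and hk, satAt_and hk, satAt_occ hI hk]
    by_cases ha : a ∈ y
    · obtain ⟨u, v, rfl, hu⟩ := exists_first_factor ha
      have e1 : x ++ (u ++ a :: v) ++ z = x ++ u ++ (a :: v ++ z) := by simp
      have e2 : x ++ (u ++ a :: v) ++ z = (x ++ u ++ [a]) ++ v ++ z := by simp
      have hu' : ∀ i, x.length ≤ i → i < x.length + u.length →
        (x ++ (u ++ a :: v) ++ z)[i]? ≠ some a := fun i => getElem?_before_anchor hu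
      have h1 := hχ x u (a :: v ++ z) (e1 ▸ hk) (by
        intro k hk
        rw [← e1] at hk ⊢
        rw [satAt_and hk, satAt_and hk, satAt_neg hk, satAt_neg hk, satAt_atom hk, satAt_bef hI hk,
          hI k hk]
        constructor
        · rintro ⟨⟨h1, h2⟩, h3, h4⟩
          refine ⟨h1, ?_⟩
          by_contra! h
          rcases h.eq_or_lt with rfl | h
          · exact h3 getElem?_anchor
          · exact h4 ⟨_, h, by simp, getElem?_anchor⟩
        · rintro ⟨h1, h2⟩
          refine ⟨⟨h1, by simp; omega⟩, hu' k h1 h2, ?_⟩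
          rintro ⟨j, hj, ⟨hj', -⟩, h⟩
          exact hu' j hj' (by omega) h)
      have h2 := hχ' (x ++ u ++ [a]) v z (e2 ▸ hk) (by
        intro k hk
        rw [← e2] at hk ⊢
        rw [satAt_and hk, satAt_bef hI hk, hI k hk]
        simp only [List.length_append, List.length_cons, List.length_nil]
        constructor
        · rintro ⟨⟨h1, h2⟩, j, hj, ⟨hj', -⟩, h⟩
          refine ⟨?_, by omega⟩
          by_contra! h'
          exact hu' j hj' (by omega) h
        · rintro ⟨h1, h2⟩
          exact ⟨⟨by omega, by omega⟩, x.length + u.length, by omega, ⟨by omega, by omega⟩,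
            getElem?_anchor⟩)
      rw [← e1] at h1
      rw [← e2] at h2
      rw [h1, h2]
      constructor
      · rintro ⟨-, h3, h4⟩; exact ⟨u, v, rfl, hu, h3, h4⟩
      · rintro ⟨u', v', e, hu', h3, h4⟩
        obtain ⟨rfl, rfl⟩ := append_cons_inj_of_notMem_left e hu hu'
        exact ⟨ha, h3, h4⟩
    · refine iff_of_false (fun h => ha h.1) ?_
      rintro ⟨u, v, rfl, -⟩
      simp at ha
  | @right a L L' _ _ ih ih' =>
    intro I
    obtain ⟨χ, hχ⟩ := ih (and I (aft a I))
    obtain ⟨χ', hχ'⟩ := ih' (and I (and (neg (atom a)) (neg (aft a I))))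
    refine ⟨and (occ a I) (and χ χ'), fun x y z hk hI => ?_⟩
    rw [satAt_and hk, satAt_and hk, satAt_occ hI hk]
    by_cases ha : a ∈ y
    · obtain ⟨u, v, rfl, hv⟩ := exists_last_factor ha
      have e1 : x ++ (u ++ a :: v) ++ z = x ++ u ++ (a :: v ++ z) := by simp
      have e2 : x ++ (u ++ a :: v) ++ z = (x ++ u ++ [a]) ++ v ++ z := by simp
      have hv' : ∀ i, x.length + u.length < i → i < x.length + (u ++ a :: v).length →
        (x ++ (u ++ a :: v) ++ z)[i]? ≠ some a := fun i => getElem?_after_anchor hv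
      simp only [List.length_append, List.length_cons] at hv'
      have h1 := hχ x u (a :: v ++ z) (e1 ▸ hk) (by
        intro k hk
        rw [← e1] at hk ⊢
        rw [satAt_and hk, satAt_aft hI hk, hI k hk]
        simp only [List.length_append, List.length_cons]
        constructor
        · rintro ⟨⟨h1, h2⟩, j, hj, ⟨-, hj'⟩, h⟩
          refine ⟨h1, ?_⟩
          by_contra! h'
          exact hv' j (by omega) hj' h
        · rintro ⟨h1, h2⟩
          exact ⟨⟨h1, by omega⟩, x.length + u.length, h2, ⟨by omega, by omega⟩, getElem?_anchor⟩)
      have h2 := hχ' (x ++ u ++ [a]) v z (e2 ▸ hk) (by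
        intro k hk
        rw [← e2] at hk ⊢
        rw [satAt_and hk, satAt_and hk, satAt_neg hk, satAt_neg hk, satAt_atom hk, satAt_aft hI hk,
          hI k hk]
        simp only [List.length_append, List.length_cons, List.length_nil]
        constructor
        · rintro ⟨⟨h1, h2⟩, h3, h4⟩
          refine ⟨?_, by omega⟩
          by_contra! h'
          rcases (show k ≤ x.length + u.length by omega).eq_or_lt with rfl | h
          · exact h3 getElem?_anchor
          · exact h4 ⟨_, h, ⟨by omega, by omega⟩, getElem?_anchor⟩
        · rintro ⟨h1, h2⟩
          refine ⟨⟨by omega, by omega⟩, hv' k (by omega) (by omega), ?_⟩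
          rintro ⟨j, hj, ⟨-, hj'⟩, h⟩
          exact hv' j (by omega) hj' h)
      rw [← e1] at h1
      rw [← e2] at h2
      rw [h1, h2]
      constructor
      · rintro ⟨-, h3, h4⟩; exact ⟨u, v, rfl, hv, h3, h4⟩
      · rintro ⟨u', v', e, hu', h3, h4⟩
        obtain ⟨rfl, rfl⟩ := append_cons_inj_of_notMem_right e hv hu'
        exact ⟨ha, h3, h4⟩
    · refine iff_of_false (fun h => ha h.1) ?_
      rintro ⟨u, v, rfl, -⟩
      simp at ha

end TLPlus

theorem tlPlusLanguages_eq [Finite A] :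
    tlPlusLanguages A = {L : Language A | L ∈ unambiguousLanguages A ∧ [] ∉ L} := by
  ext L
  simp only [Set.mem_ofPred_eq, mem_unambiguousLanguages_iff_detSet]
  constructor
  · rintro ⟨ψ, rfl⟩
    obtain ⟨n, hn⟩ := ψ.exists_piecewiseLevel
    refine ⟨DetSet.of_profileClosed (n := n + 2) fun w w' e hw => ?_, fun h => ?_⟩
    · exact TLPlus.mem_language_iff.2
        (hn.hasLevel.profileClosed_zero w w' e (TLPlus.mem_language_iff.1 hw))
    · exact absurd (TLPlus.mem_language_iff.1 h).1 (by simp)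
  · rintro ⟨hL, hnil⟩
    obtain ⟨χ, hχ⟩ := TLPlus.exists_satAt_iff_mem hL (.ranker .top)
    refine ⟨χ, ?_⟩
    ext w
    rw [TLPlus.mem_language_iff]
    by_cases hw : 0 < w.length
    · have := hχ [] w [] (by simpa using hw) (by
        intro k hk
        rw [TLPlus.satAt_ranker, RecRanker.satAt_top hk]
        simpa using hk)
      simp only [List.nil_append, List.append_nil] at this
      rw [this]
      exact ⟨fun h => h.2, fun h => ⟨hw, h⟩⟩
    · obtain rfl : w = [] := by simpa using hw
      simpa using hnil

end TLPlusDefinability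

section TLXYDefinability

variable {A : Type u}

namespace TLXY

/-- Conjunction. -/
def and (φ φ' : TLXY A) : TLXY A := neg (or (neg φ) (neg φ'))

theorem satAt_and {φ φ' : TLXY A} {w : List A} {k : ℕ} (h : k < w.length) :
    (and φ φ').satAt w k ↔ φ.satAt w k ∧ φ'.satAt w k := by
  rw [and, satAt_neg h, satAt_or h, satAt_neg h, satAt_neg h]
  tauto

/-- Formulas that locate a factor of a word: `mem` marks its positions, `first a φ` and `last a φ`
evaluate `φ` at its first and last occurrence of `a`. -/
structure Locator (A : Type u) where
  mem : TLXY A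
  first : A → TLXY A → TLXY A
  last : A → TLXY A → TLXY A

/-- The formulas of `E` locate the factor `y` of `x ++ y ++ z`. -/
structure Locator.Locates (E : Locator A) (x y z : List A) : Prop where
  mem : ∀ k < (x ++ y ++ z).length,
    (E.mem.satAt (x ++ y ++ z) k ↔ x.length ≤ k ∧ k < x.length + y.length)
  first : ∀ a φ, ∀ k < (x ++ y ++ z).length, ((E.first a φ).satAt (x ++ y ++ z) k ↔
    ∃ j, (x.length ≤ j ∧ j < x.length + y.length) ∧ (x ++ y ++ z)[j]? = some a ∧
      φ.satAt (x ++ y ++ z) j ∧ ∀ i, x.length ≤ i → i < j → ¬ (x ++ y ++ z)[i]? = some a)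
  last : ∀ a φ, ∀ k < (x ++ y ++ z).length, ((E.last a φ).satAt (x ++ y ++ z) k ↔
    ∃ j, (x.length ≤ j ∧ j < x.length + y.length) ∧ (x ++ y ++ z)[j]? = some a ∧
      φ.satAt (x ++ y ++ z) j ∧
      ∀ i, j < i → i < x.length + y.length → ¬ (x ++ y ++ z)[i]? = some a)

namespace Locator

/-- The locator of the part before the position reached by `g`, whose positions `I` marks. -/
def before (E : Locator A) (g : TLXY A → TLXY A) (I : TLXY A) : Locator A where
  mem := I
  first b φ := E.first b (and I φ)
  last b φ := g (Y b (and I φ))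

/-- The locator of the part after the position reached by `g`, whose positions `I` marks. -/
def after (E : Locator A) (g : TLXY A → TLXY A) (I : TLXY A) : Locator A where
  mem := I
  first b φ := g (X b (and I φ))
  last b φ := E.last b (and I φ)

variable {E : Locator A} {g : TLXY A → TLXY A} {I : TLXY A} {a : A} {x u v z : List A}

theorem Locates.before (hE : E.Locates x (u ++ a :: v) z)
    (hg : ∀ φ, ∀ k < (x ++ (u ++ a :: v) ++ z).length,
      ((g φ).satAt (x ++ (u ++ a :: v) ++ z) k ↔
        φ.satAt (x ++ (u ++ a :: v) ++ z) (x.length + u.length)))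
    (hI : ∀ k < (x ++ (u ++ a :: v) ++ z).length, (I.satAt (x ++ (u ++ a :: v) ++ z) k ↔
      x.length ≤ k ∧ k < x.length + u.length)) :
    (E.before g I).Locates x u (a :: v ++ z) := by
  have e : x ++ u ++ (a :: v ++ z) = x ++ (u ++ a :: v) ++ z := by simp
  have hl : x.length + u.length < (x ++ (u ++ a :: v) ++ z).length := by simp
  constructor
  · rw [e]; exact hI
  · intro b φ k hk
    rw [e] at hk ⊢
    refine (hE.first b _ k hk).trans (exists_congr fun j => ?_)
    constructor
    · rintro ⟨h1, h2, h3, h4⟩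
      have hj := (List.getElem?_eq_some_iff.1 h2).1
      rw [satAt_and hj, hI j hj] at h3
      exact ⟨h3.1, h2, h3.2, h4⟩
    · rintro ⟨h1, h2, h3, h4⟩
      have hj := (List.getElem?_eq_some_iff.1 h2).1
      refine ⟨⟨h1.1, by simp; omega⟩, h2, ?_, h4⟩
      rw [satAt_and hj, hI j hj]
      exact ⟨h1, h3⟩
  · intro b φ k hk
    rw [e] at hk ⊢
    refine ((hg _ k hk).trans (satAt_Y hl)).trans (exists_congr fun j => ?_)
    constructor
    · rintro ⟨h1, h2, h3, h4⟩
      have hj := (List.getElem?_eq_some_iff.1 h2).1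
      rw [satAt_and hj, hI j hj] at h3
      exact ⟨h3.1, h2, h3.2, h4⟩
    · rintro ⟨h1, h2, h3, h4⟩
      have hj := (List.getElem?_eq_some_iff.1 h2).1
      refine ⟨h1.2, h2, ?_, h4⟩
      rw [satAt_and hj, hI j hj]
      exact ⟨h1, h3⟩

theorem Locates.after (hE : E.Locates x (u ++ a :: v) z)
    (hg : ∀ φ, ∀ k < (x ++ (u ++ a :: v) ++ z).length,
      ((g φ).satAt (x ++ (u ++ a :: v) ++ z) k ↔
        φ.satAt (x ++ (u ++ a :: v) ++ z) (x.length + u.length)))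
    (hI : ∀ k < (x ++ (u ++ a :: v) ++ z).length, (I.satAt (x ++ (u ++ a :: v) ++ z) k ↔
      x.length + u.length < k ∧ k < x.length + (u ++ a :: v).length)) :
    (E.after g I).Locates (x ++ u ++ [a]) v z := by
  have e : (x ++ u ++ [a]) ++ v ++ z = x ++ (u ++ a :: v) ++ z := by simp
  have hl : x.length + u.length < (x ++ (u ++ a :: v) ++ z).length := by simp
  have l1 : (x ++ u ++ [a]).length = x.length + u.length + 1 := by simp; omega
  have l2 : (u ++ a :: v).length = u.length + 1 + v.length := by simp; omega
  constructor
  · intro k hk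
    rw [e] at hk ⊢
    refine (hI k hk).trans ?_
    omega
  · intro b φ k hk
    rw [e] at hk ⊢
    refine ((hg _ k hk).trans (satAt_X hl)).trans (exists_congr fun j => ?_)
    constructor
    · rintro ⟨h1, hj, h2, h3, h4⟩
      rw [satAt_and hj, hI j hj] at h3
      exact ⟨by omega, h2, h3.2, fun i h5 h6 => h4 i (by omega) h6⟩
    · rintro ⟨h1, h2, h3, h4⟩
      have hj := (List.getElem?_eq_some_iff.1 h2).1
      refine ⟨by omega, hj, h2, ?_, fun i h5 h6 => h4 i (by omega) h6⟩
      rw [satAt_and hj, hI j hj]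
      exact ⟨by omega, h3⟩
  · intro b φ k hk
    rw [e] at hk ⊢
    refine (hE.last b _ k hk).trans (exists_congr fun j => ?_)
    constructor
    · rintro ⟨h1, h2, h3, h4⟩
      have hj := (List.getElem?_eq_some_iff.1 h2).1
      rw [satAt_and hj, hI j hj] at h3
      exact ⟨by omega, h2, h3.2, fun i h5 h6 => h4 i h5 (by omega)⟩
    · rintro ⟨h1, h2, h3, h4⟩
      have hj := (List.getElem?_eq_some_iff.1 h2).1
      refine ⟨by omega, h2, ?_, fun i h5 h6 => h4 i h5 (by omega)⟩
      rw [satAt_and hj, hI j hj]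
      exact ⟨by omega, h3⟩

theorem Locates.satAt_first_iff (hE : E.Locates x (u ++ a :: v) z) (hu : a ∉ u) {φ : TLXY A}
    {k : ℕ} (hk : k < (x ++ (u ++ a :: v) ++ z).length) :
    (E.first a φ).satAt (x ++ (u ++ a :: v) ++ z) k ↔
      φ.satAt (x ++ (u ++ a :: v) ++ z) (x.length + u.length) := by
  rw [hE.first a φ k hk]
  constructor
  · rintro ⟨j, h1, h2, h3, h4⟩
    rcases lt_trichotomy j (x.length + u.length) with h | rfl | h
    · exact absurd h2 (getElem?_before_anchor hu h1.1 h)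
    · exact h3
    · exact absurd getElem?_anchor (h4 _ (by omega) h)
  · intro h
    exact ⟨_, ⟨by omega, by simp⟩, getElem?_anchor, h, fun i h1 h2 =>
      getElem?_before_anchor hu h1 h2⟩

theorem Locates.satAt_last_iff (hE : E.Locates x (u ++ a :: v) z) (hv : a ∉ v) {φ : TLXY A}
    {k : ℕ} (hk : k < (x ++ (u ++ a :: v) ++ z).length) :
    (E.last a φ).satAt (x ++ (u ++ a :: v) ++ z) k ↔
      φ.satAt (x ++ (u ++ a :: v) ++ z) (x.length + u.length) := by
  rw [hE.last a φ k hk]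
  constructor
  · rintro ⟨j, h1, h2, h3, h4⟩
    rcases lt_trichotomy j (x.length + u.length) with h | rfl | h
    · exact absurd getElem?_anchor (h4 _ h (by simp))
    · exact h3
    · exact absurd h2 (getElem?_after_anchor hv h h1.2)
  · intro h
    exact ⟨_, ⟨by omega, by simp⟩, getElem?_anchor, h, fun i h1 h2 =>
      getElem?_after_anchor hv h1 h2⟩

theorem Locates.satAt_first_top_iff {y : List A} (hE : E.Locates x y z) {k : ℕ}
    (hk : k < (x ++ y ++ z).length) :
    (E.first a .top).satAt (x ++ y ++ z) k ↔ a ∈ y := by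
  by_cases ha : a ∈ y
  · obtain ⟨u, v, rfl, hu⟩ := exists_first_factor ha
    rw [hE.satAt_first_iff hu hk, satAt_top (by simp)]
    simp
  · refine iff_of_false (fun h => ha ?_) ha
    rw [hE.first a _ k hk] at h
    obtain ⟨j, h1, h2, -⟩ := h
    exact exists_getElem?_factor_iff.1 ⟨j, h1.1, h1.2, h2⟩

end Locator

theorem exists_satAt_iff_mem {L : Set (List A)} (hL : DetSet L) : ∀ E : Locator A,
    ∃ χ : TLXY A, ∀ x y z, E.Locates x y z → ∀ k < (x ++ y ++ z).length,
      (χ.satAt (x ++ y ++ z) k ↔ y ∈ L) := by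
  induction hL with
  | univ =>
    exact fun E => ⟨.top, fun x y z _ k hk => by rw [satAt_top hk]; simp⟩
  | avoid a =>
    exact fun E => ⟨neg (E.first a .top), fun x y z hE k hk => by
      rw [satAt_neg hk, hE.satAt_first_top_iff hk]; rfl⟩
  | compl _ ih =>
    intro E
    obtain ⟨χ, hχ⟩ := ih E
    exact ⟨neg χ, fun x y z hE k hk => by rw [satAt_neg hk, hχ x y z hE k hk]; rfl⟩
  | union _ _ ih ih' =>
    intro E
    obtain ⟨χ, hχ⟩ := ih E
    obtain ⟨χ', hχ'⟩ := ih' E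
    exact ⟨or χ χ', fun x y z hE k hk => by
      rw [satAt_or hk, hχ x y z hE k hk, hχ' x y z hE k hk]; rfl⟩
  | @left a L L' _ _ ih ih' =>
    intro E
    obtain ⟨χ, hχ⟩ := ih (E.before (E.first a) (and E.mem (neg (weakY a E.mem))))
    obtain ⟨χ', hχ'⟩ := ih' (E.after (E.first a) (and E.mem (Y a E.mem)))
    refine ⟨and (E.first a .top) (and χ χ'), fun x y z hE k hk => ?_⟩
    rw [satAt_and hk, satAt_and hk, hE.satAt_first_top_iff hk]
    by_cases ha : a ∈ y
    · obtain ⟨u, v, rfl, hu⟩ := exists_first_factor ha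
      have e1 : x ++ (u ++ a :: v) ++ z = x ++ u ++ (a :: v ++ z) := by simp
      have e2 : x ++ (u ++ a :: v) ++ z = (x ++ u ++ [a]) ++ v ++ z := by simp
      have l2 : (u ++ a :: v).length = u.length + 1 + v.length := by simp; omega
      have hu' : ∀ i, x.length ≤ i → i < x.length + u.length →
        (x ++ (u ++ a :: v) ++ z)[i]? ≠ some a := fun i => getElem?_before_anchor hu
      have hg := fun φ k hk => hE.satAt_first_iff (φ := φ) (k := k) hu hk
      have h1 := hχ x u (a :: v ++ z) (hE.before hg (by
        intro k hk
        rw [satAt_and hk, satAt_neg hk, satAt_weakY hk, hE.mem k hk]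
        constructor
        · rintro ⟨⟨h1, h2⟩, h3⟩
          refine ⟨h1, ?_⟩
          by_contra! h
          let Q : ℕ → Prop := fun i => (x ++ (u ++ a :: v) ++ z)[i]? = some a
          classical
          have h0 : Q (Nat.findGreatest Q k) := Nat.findGreatest_spec h getElem?_anchor
          have h4 : x.length + u.length ≤ Nat.findGreatest Q k :=
            Nat.le_findGreatest h getElem?_anchor
          have h5 : Nat.findGreatest Q k ≤ k := Nat.findGreatest_le k
          exact h3 ⟨_, h5, h0, (hE.mem _ (by omega)).2 ⟨by omega, by omega⟩,
            fun i h6 h7 => Nat.findGreatest_is_greatest h6 h7⟩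
        · rintro ⟨h1, h2⟩
          refine ⟨⟨h1, by omega⟩, ?_⟩
          rintro ⟨j, hj, h3, h4, -⟩
          rw [hE.mem j (by omega)] at h4
          exact hu' j h4.1 (by omega) h3)) k (e1 ▸ hk)
      have h2 := hχ' (x ++ u ++ [a]) v z (hE.after hg (by
        intro k hk
        rw [satAt_and hk, satAt_Y hk, hE.mem k hk]
        constructor
        · rintro ⟨⟨h1, h2⟩, j, hj, h3, h4, -⟩
          rw [hE.mem j (by omega)] at h4
          refine ⟨?_, h2⟩
          by_contra! h
          exact hu' j h4.1 (by omega) h3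
        · rintro ⟨h1, h2⟩
          refine ⟨⟨by omega, h2⟩, ?_⟩
          let Q : ℕ → Prop := fun i => (x ++ (u ++ a :: v) ++ z)[i]? = some a
          classical
          have h : x.length + u.length ≤ k - 1 := by omega
          have h0 : Q (Nat.findGreatest Q (k - 1)) := Nat.findGreatest_spec h getElem?_anchor
          have h4 : x.length + u.length ≤ Nat.findGreatest Q (k - 1) :=
            Nat.le_findGreatest h getElem?_anchor
          have h5 : Nat.findGreatest Q (k - 1) ≤ k - 1 := Nat.findGreatest_le _
          exact ⟨_, by omega, h0, (hE.mem _ (by omega)).2 ⟨by omega, by omega⟩,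
            fun i h6 h7 => Nat.findGreatest_is_greatest h6 (by omega)⟩)) k (e2 ▸ hk)
      rw [← e1] at h1
      rw [← e2] at h2
      rw [h1, h2]
      constructor
      · rintro ⟨-, h3, h4⟩; exact ⟨u, v, rfl, hu, h3, h4⟩
      · rintro ⟨u', v', e, hu', h3, h4⟩
        obtain ⟨rfl, rfl⟩ := append_cons_inj_of_notMem_left e hu hu'
        exact ⟨ha, h3, h4⟩
    · refine iff_of_false (fun h => ha h.1) ?_
      rintro ⟨u, v, rfl, -⟩
      simp at ha
  | @right a L L' _ _ ih ih' =>
    intro E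
    obtain ⟨χ, hχ⟩ := ih (E.before (E.last a) (and E.mem (X a E.mem)))
    obtain ⟨χ', hχ'⟩ := ih' (E.after (E.last a) (and E.mem (neg (weakX a E.mem))))
    refine ⟨and (E.first a .top) (and χ χ'), fun x y z hE k hk => ?_⟩
    rw [satAt_and hk, satAt_and hk, hE.satAt_first_top_iff hk]
    by_cases ha : a ∈ y
    · obtain ⟨u, v, rfl, hv⟩ := exists_last_factor ha
      have e1 : x ++ (u ++ a :: v) ++ z = x ++ u ++ (a :: v ++ z) := by simp
      have e2 : x ++ (u ++ a :: v) ++ z = (x ++ u ++ [a]) ++ v ++ z := by simp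
      have l2 : (u ++ a :: v).length = u.length + 1 + v.length := by simp; omega
      have hl : x.length + u.length < (x ++ (u ++ a :: v) ++ z).length := by simp
      have hv' : ∀ i, x.length + u.length < i → i < x.length + (u ++ a :: v).length →
        (x ++ (u ++ a :: v) ++ z)[i]? ≠ some a := fun i => getElem?_after_anchor hv
      have hg := fun φ k hk => hE.satAt_last_iff (φ := φ) (k := k) hv hk
      have h1 := hχ x u (a :: v ++ z) (hE.before hg (by
        intro k hk
        rw [satAt_and hk, satAt_X hk, hE.mem k hk]
        constructor
        · rintro ⟨⟨h1, h2⟩, j, hj, hjl, h3, h4, -⟩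
          rw [hE.mem j hjl] at h4
          refine ⟨h1, ?_⟩
          by_contra! h
          exact hv' j (by omega) h4.2 h3
        · rintro ⟨h1, h2⟩
          refine ⟨⟨h1, by omega⟩, ?_⟩
          have hex : ∃ i, k < i ∧ (x ++ (u ++ a :: v) ++ z)[i]? = some a :=
            ⟨_, h2, getElem?_anchor⟩
          classical
          obtain ⟨h3, h4⟩ := Nat.find_spec hex
          have h5 : Nat.find hex ≤ x.length + u.length := Nat.find_min' hex ⟨h2, getElem?_anchor⟩
          exact ⟨_, h3, by omega, h4, (hE.mem _ (by omega)).2 ⟨by omega, by omega⟩,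
            fun i h6 h7 h8 => Nat.find_min hex h7 ⟨h6, h8⟩⟩)) k (e1 ▸ hk)
      have h2 := hχ' (x ++ u ++ [a]) v z (hE.after hg (by
        intro k hk
        rw [satAt_and hk, satAt_neg hk, satAt_weakX hk, hE.mem k hk]
        constructor
        · rintro ⟨⟨h1, h2⟩, h3⟩
          refine ⟨?_, h2⟩
          by_contra! h
          have hex : ∃ i, k ≤ i ∧ (x ++ (u ++ a :: v) ++ z)[i]? = some a :=
            ⟨_, h, getElem?_anchor⟩
          classical
          obtain ⟨h4, h5⟩ := Nat.find_spec hex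
          have h6 : Nat.find hex ≤ x.length + u.length := Nat.find_min' hex ⟨h, getElem?_anchor⟩
          exact h3 ⟨_, h4, by omega, h5, (hE.mem _ (by omega)).2 ⟨by omega, by omega⟩,
            fun i h6 h7 h8 => Nat.find_min hex h7 ⟨h6, h8⟩⟩
        · rintro ⟨h1, h2⟩
          refine ⟨⟨by omega, h2⟩, ?_⟩
          rintro ⟨j, hj, hjl, h3, h4, -⟩
          rw [hE.mem j hjl] at h4
          exact hv' j (by omega) h4.2 h3)) k (e2 ▸ hk)
      rw [← e1] at h1
      rw [← e2] at h2
      rw [h1, h2]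
      constructor
      · rintro ⟨-, h3, h4⟩; exact ⟨u, v, rfl, hv, h3, h4⟩
      · rintro ⟨u', v', e, hu', h3, h4⟩
        obtain ⟨rfl, rfl⟩ := append_cons_inj_of_notMem_right e hv hu'
        exact ⟨ha, h3, h4⟩
    · refine iff_of_false (fun h => ha h.1) ?_
      rintro ⟨u, v, rfl, -⟩
      simp at ha

/-- The locator of the whole word. -/
def Locator.whole (A : Type u) : Locator A where
  mem := .top
  first a φ := SP (weakX a φ)
  last a φ := EP (weakY a φ)

theorem Locator.locates_whole (w : List A) : (Locator.whole A).Locates [] w [] := by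
  constructor
  · intro k hk
    refine (satAt_top hk).trans ?_
    simpa using hk
  · intro a φ k hk
    refine (satAt_SP hk).trans ((satAt_weakX (by omega)).trans (exists_congr fun j => ?_))
    simp
  · intro a φ k hk
    refine (satAt_EP hk).trans ((satAt_weakY (by omega)).trans (exists_congr fun j => ?_))
    simp only [List.nil_append, List.append_nil, List.length_nil, zero_add, Nat.zero_le,
      true_and] at hk ⊢
    refine and_congr ⟨fun h => by omega, fun h => by omega⟩ (and_congr Iff.rfl (and_congr Iff.rfl
      (forall_congr' fun i => forall_congr' fun _ => ?_)))
    exact ⟨fun h h' => h (by omega), fun h h' => h (by omega)⟩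

end TLXY

theorem tlxyLanguages_eq [Finite A] :
    tlxyLanguages A = {L : Language A | L ∈ unambiguousLanguages A ∧ [] ∉ L} := by
  ext L
  simp only [Set.mem_ofPred_eq, mem_unambiguousLanguages_iff_detSet]
  constructor
  · rintro ⟨φ, rfl⟩
    obtain ⟨n, hn⟩ := φ.exists_hasLevel
    refine ⟨DetSet.of_profileClosed (n := n + 2) fun w w' e hw => ?_, fun h => ?_⟩
    · exact TLXY.mem_language_iff.2 (hn.profileClosed_zero w w' e (TLXY.mem_language_iff.1 hw))
    · exact absurd (TLXY.mem_language_iff.1 h).1 (by simp)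
  · rintro ⟨hL, hnil⟩
    obtain ⟨χ, hχ⟩ := TLXY.exists_satAt_iff_mem hL (.whole A)
    refine ⟨χ, ?_⟩
    ext w
    rw [TLXY.mem_language_iff]
    by_cases hw : 0 < w.length
    · have := hχ [] w [] (TLXY.Locator.locates_whole w) 0 (by simpa using hw)
      simp only [List.nil_append, List.append_nil] at this
      rw [this]
      exact ⟨fun h => h.2, fun h => ⟨hw, h⟩⟩
    · obtain rfl : w = [] := by simpa using hw
      simpa using hnil

end TLXYDefinability

theorem mainTheorem4 {A : Type*} [Finite A] :
    tlPlusLanguages A = tlxyLanguages A ∧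
    tlxyLanguages A = {L : Language A | L ∈ unambiguousLanguages A ∧ [] ∉ L} :=
  ⟨tlPlusLanguages_eq.trans tlxyLanguages_eq.symm, tlxyLanguages_eq⟩
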